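/- All objects are smooth. For a smooth map $\varphi:(M,g)\to(N,h)$ of Riemannian manifolds let $\tau(\varphi)=\mathrm{Trace}_g\nabla d\varphi$ be its tension field and, for a section $X$ of $\varphi^{-1}TN$, let $$J^{\varphi}(X)=-\{\mathrm{Trace}_g(\nabla^{\varphi}\nabla^{\varphi}-\nabla^{\varphi}_{\nabla^M})X-\mathrm{Trace}_gR^N(d\varphi,X)d\varphi\}$$ be the Jacobi operator, where $R^N(X,Y)Z=[\nabla^N_X,\nabla^N_Y]Z-\nabla^N_{[X,Y]}Z$. For $f:M\to(0,\infty)$, the map $\varphi$ is called $f$-biharmonic if it satisfies the $f$-biharmonic map equation $\tau_{2,f}(\varphi):=-J^{\varphi}(f\tau(\varphi))=0$. Let $\pi:(M^3,g)\to(N^2,h)$ be a Riemannian submersion, $f:M\to(0,\infty)$ a smooth function, and $\{e_1,e_2,e_3\}$ an orthonormal frame on an open set $U\subseteq M$ that is adapted to $\pi$: $e_3$ is vertical, and $e_1,e_2$ are basic, i.e. $\pi$-related to a smooth orthonormal frame $\varepsilon_1,\varepsilon_2$ on an open set of $N$ containing $\pi(U)$. Let $\{f_1,f_2,\kappa_1,\kappa_2,\sigma\}$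 be its integrability data, the functions on $U$ with $$[e_1,e_3]=\kappa_1e_3,\qquad [e_2,e_3]=\kappa_2e_3,\qquad [e_1,e_2]=f_1e_1+f_2e_2-2\sigma e_3 .$$ Let $K^N$ be the Gauss curvature of $(N,h)$, composed with $\pi$. Then on $U$ $$K^N=e_1(f_2)-e_2(f_1)-f_1^2-f_2^2,$$ and $\pi$ is $f$-biharmonic on $U$ if and only if on $U$ $$\begin{cases} -\Delta^{M}(f\kappa_1)-2\sum_{i=1}^{2}f_i\,e_i(f\kappa_2)-f\kappa_2\sum_{i=1}^{2}\left(e_i(f_i)-\kappa_if_i\right)+f\kappa_1\left(-K^{N}+\sum_{i=1}^{2}f_i^{2}\right)=0,\\ -\Delta^{M}(f\kappa_2)+2\sum_{i=1}^{2}f_i\,e_i(f\kappa_1)+f\kappa_1\sum_{i=1}^{2}\left(e_i(f_i)-\kappa_if_i\right)+f\kappa_2\left(-K^{N}+\sum_{i=1}^{2}f_i^{2}\right)=0, \end{cases}$$ where $\Delta^M=\mathrm{Trace}_g\nabla d$ is the Laplace-Beltrami operator of $(M,g)$. (If the frame is global, take $U=M$.) -/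

import Mathlib

open Bundle Set
open scoped Manifold ContDiff RealInnerProductSpace

noncomputable section

namespace FBiharmonic

section Riemannian

variable {E : Type*} [NormedAddCommGroup E] [NormedSpace ℝ E] [FiniteDimensional ℝ E]
  {H : Type*} [TopologicalSpace H] (I : ModelWithCorners ℝ E H)
  {M : Type*} [TopologicalSpace M] [ChartedSpace H M]

instance instFiniteDimensionalTangentSpace (x : M) : FiniteDimensional ℝ (TangentSpace I x) :=
  inferInstanceAs (FiniteDimensional ℝ E)

variable [IsManifold I ∞ M] [RiemannianBundle (fun x : M => TangentSpace I x)]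

/-- The right-hand side of the Koszul formula, that is `⟨∇_X Y, Z⟩` at the point `x` for the
Levi-Civita connection `∇`. -/
def koszul (X Y Z : Π x : M, TangentSpace I x) (x : M) : ℝ :=
  (1 / 2 : ℝ) *
    (mvfderiv I (fun y => ⟪Y y, Z y⟫) x (X x)
      + mvfderiv I (fun y => ⟪X y, Z y⟫) x (Y x)
      - mvfderiv I (fun y => ⟪X y, Y y⟫) x (Z x)
      + ⟪VectorField.mlieBracket I X Y x, Z x⟫
      - ⟪VectorField.mlieBracket I X Z x, Y x⟫
      - ⟪VectorField.mlieBracket I Y Z x, X x⟫)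

/-- An orthonormal basis of the tangent space at `x`. Everything below that uses it is independent
of the choice. -/
def onb (x : M) : OrthonormalBasis (Fin (Module.finrank ℝ (TangentSpace I x))) ℝ
    (TangentSpace I x) :=
  stdOrthonormalBasis ℝ (TangentSpace I x)

/-- A local extension of a tangent vector at `x` to a vector field that is smooth near `x`
(constant components in the preferred chart at `x`). -/
def extendVec {x : M} (v : TangentSpace I x) : Π y : M, TangentSpace I y :=
  FiberBundle.extend E (E := fun y : M => TangentSpace I y) v

/-- The Levi-Civita connection: `leviCivita I Y x v = ∇_v Y`, the vector whose inner products are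
given by the Koszul formula. -/
def leviCivita (Y : Π x : M, TangentSpace I x) (x : M) (v : TangentSpace I x) :
    TangentSpace I x :=
  ∑ i, koszul I (extendVec I v) Y (extendVec I (onb I x i)) x • onb I x i

/-- The curvature `R(u, v) w = ∇_u ∇_v w - ∇_v ∇_u w - ∇_{[u, v]} w`. -/
def curvature (x : M) (u v w : TangentSpace I x) : TangentSpace I x :=
  leviCivita I (fun y => leviCivita I (extendVec I w) y (extendVec I v y)) x u
    - leviCivita I (fun y => leviCivita I (extendVec I w) y (extendVec I u y)) x v
    - leviCivita I (extendVec I w) x (VectorField.mlieBracket I (extendVec I u) (extendVec I v) x)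

/-- The sectional curvature of the plane spanned by two linearly independent vectors. -/
def sectionalCurvature (x : M) (u v : TangentSpace I x) : ℝ :=
  ⟪curvature I x u v v, u⟫ / (‖u‖ ^ 2 * ‖v‖ ^ 2 - ⟪u, v⟫ ^ 2)

/-- The Laplace-Beltrami operator, `Δ u = trace ∇ d u` (so `Δ = ∑ ∂ᵢ²` in Euclidean space). -/
def laplacian (u : M → ℝ) (x : M) : ℝ :=
  ∑ i, (mvfderiv I (fun y => mvfderiv I u y (extendVec I (onb I x i) y)) x (onb I x i)
    - mvfderiv I u x (leviCivita I (extendVec I (onb I x i)) x (onb I x i)))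

end Riemannian

section Maps

variable {E : Type*} [NormedAddCommGroup E] [NormedSpace ℝ E] [FiniteDimensional ℝ E]
  {H : Type*} [TopologicalSpace H] (I : ModelWithCorners ℝ E H)
  {M : Type*} [TopologicalSpace M] [ChartedSpace H M] [IsManifold I ∞ M]
  [RiemannianBundle (fun x : M => TangentSpace I x)]
  {E' : Type*} [NormedAddCommGroup E'] [NormedSpace ℝ E'] [FiniteDimensional ℝ E']
  {H' : Type*} [TopologicalSpace H'] (J : ModelWithCorners ℝ E' H')
  {N : Type*} [TopologicalSpace N] [ChartedSpace H' N] [IsManifold J ∞ N]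
  [RiemannianBundle (fun q : N => TangentSpace J q)]

/-- The connection `∇^φ` induced on `φ⁻¹TN` by the Levi-Civita connection of `N`:
`pullbackConnection I J φ W x v = ∇^φ_v W`. If `Eₐ` is the local frame of `TN` given by the
preferred trivialization at `φ x` and `W = ∑ wᵃ Eₐ ∘ φ`, then
`∇^φ_v W = ∑ (v wᵃ) Eₐ (φ x) + ∑ wᵃ(x) ∇^N_{dφ v} Eₐ`. -/
def pullbackConnection (φ : M → N) (W : Π x : M, TangentSpace J (φ x)) (x : M)
    (v : TangentSpace I x) : TangentSpace J (φ x) :=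
  (trivializationAt E' (fun q : N => TangentSpace J q) (φ x)).symm (φ x)
      (mvfderiv I (fun y => (trivializationAt E' (fun q : N => TangentSpace J q) (φ x)
        (⟨φ y, W y⟩ : TotalSpace E' (fun q : N => TangentSpace J q))).2) x v)
    + leviCivita J (extendVec J (W x)) (φ x) (mfderiv I J φ x v)

/-- The tension field `τ(φ) = Trace_g ∇ dφ`. -/
def tension (φ : M → N) (x : M) : TangentSpace J (φ x) :=
  ∑ i, (pullbackConnection I J φ (fun y => mfderiv I J φ y (extendVec I (onb I x i) y)) x (onb I x i)
    - mfderiv I J φ x (leviCivita I (extendVec I (onb I x i)) x (onb I x i)))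

/-- The Jacobi operator of `φ`,
`J^φ(W) = -{Trace_g (∇^φ ∇^φ - ∇^φ_{∇^M}) W - Trace_g R^N(dφ, W) dφ}`. -/
def jacobiOperator (φ : M → N) (W : Π x : M, TangentSpace J (φ x)) (x : M) :
    TangentSpace J (φ x) :=
  -((∑ i, (pullbackConnection I J φ
        (fun y => pullbackConnection I J φ W y (extendVec I (onb I x i) y)) x (onb I x i)
      - pullbackConnection I J φ W x (leviCivita I (extendVec I (onb I x i)) x (onb I x i))))
    - ∑ i, curvature J (φ x) (mfderiv I J φ x (onb I x i)) (W x)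
        (mfderiv I J φ x (onb I x i)))

/-- The `f`-bitension field `τ_{2,f}(φ) = -J^φ(f τ(φ))`. -/
def fBitension (f : M → ℝ) (φ : M → N) (x : M) : TangentSpace J (φ x) :=
  -jacobiOperator I J φ (fun y => f y • tension I J φ y) x

/-- The map `φ` is `f`-biharmonic on the set `U`: it solves the `f`-biharmonic map equation
`τ_{2,f}(φ) = 0` on `U`. -/
def IsFBiharmonicOn (f : M → ℝ) (φ : M → N) (U : Set M) : Prop :=
  ∀ x ∈ U, fBitension I J f φ x = 0

/-- A (smooth) Riemannian submersion: every differential is onto, and it preserves the length of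
horizontal vectors, those orthogonal to its kernel. -/
structure IsRiemannianSubmersion (p : M → N) : Prop where
  smooth : ContMDiff I J ∞ p
  surjective : ∀ x, Function.Surjective (mfderiv I J p x)
  norm_map : ∀ x, ∀ v : TangentSpace I x,
    (∀ w : TangentSpace I x, mfderiv I J p x w = 0 → ⟪v, w⟫ = 0) → ‖mfderiv I J p x v‖ = ‖v‖

end Maps

theorem finrank_tangentSpace_two {N : Type*} [TopologicalSpace N]
    [ChartedSpace (EuclideanSpace ℝ (Fin 2)) N] (q : N) :
    Module.finrank ℝ (TangentSpace (𝓡 2) q) = 2 :=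
  (finrank_euclideanSpace_fin : Module.finrank ℝ (EuclideanSpace ℝ (Fin 2)) = 2)

section ThreeToTwo

variable {M : Type*} [TopologicalSpace M] [ChartedSpace (EuclideanSpace ℝ (Fin 3)) M]
  [IsManifold (𝓡 3) ∞ M] [RiemannianBundle (fun x : M => TangentSpace (𝓡 3) x)]
  {N : Type*} [TopologicalSpace N] [ChartedSpace (EuclideanSpace ℝ (Fin 2)) N]
  [IsManifold (𝓡 2) ∞ N] [RiemannianBundle (fun q : N => TangentSpace (𝓡 2) q)]

/-- The Gauss curvature of a Riemannian surface: the sectional curvature of its tangent plane. -/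
def gaussCurvature (q : N) : ℝ :=
  sectionalCurvature (𝓡 2) q
    (onb (𝓡 2) q (Fin.cast (finrank_tangentSpace_two q).symm 0))
    (onb (𝓡 2) q (Fin.cast (finrank_tangentSpace_two q).symm 1))

/-- A smooth orthonormal frame `e 0, e 1, e 2` on `U` (written `e₁, e₂, e₃` on paper) is adapted to
`p` if `e₃` is vertical and `e₁, e₂` are basic, that is `p`-related to a smooth orthonormal frame
`ε₁, ε₂` on an open set containing `p(U)`. -/
structure IsAdaptedFrame (p : M → N) (U : Set M) (e : Fin 3 → Π x : M, TangentSpace (𝓡 3) x) :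
    Prop where
  smooth : ∀ i, ContMDiffOn (𝓡 3) (𝓡 3).tangent ∞
    (fun x => (⟨x, e i x⟩ : TangentBundle (𝓡 3) M)) U
  orthonormal : ∀ x ∈ U, Orthonormal ℝ (fun i => e i x)
  vertical : ∀ x ∈ U, mfderiv (𝓡 3) (𝓡 2) p x (e 2 x) = 0
  basic : ∃ (V : Set N) (ε : Fin 2 → Π q : N, TangentSpace (𝓡 2) q),
    IsOpen V ∧ MapsTo p U V ∧
    (∀ i, ContMDiffOn (𝓡 2) (𝓡 2).tangent ∞ (fun q => (⟨q, ε i q⟩ : TangentBundle (𝓡 2) N)) V) ∧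
    (∀ q ∈ V, Orthonormal ℝ (fun i => ε i q)) ∧
    ∀ x ∈ U, ∀ i : Fin 2, mfderiv (𝓡 3) (𝓡 2) p x (e i.castSucc x) = ε i (p x)

/-- The coefficient of `e k` in the expansion of `[e i, e j]` in the orthonormal frame `e`. -/
def bracketCoeff (e : Fin 3 → Π x : M, TangentSpace (𝓡 3) x) (i j k : Fin 3) (x : M) : ℝ :=
  ⟪VectorField.mlieBracket (𝓡 3) (e i) (e j) x, e k x⟫

/-- The functions `f₁, f₂, κ₁, κ₂, σ` on `U` are the integrability data of the adapted frame `e`: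
the coefficients in `[e₁, e₃] = κ₁ e₃`, `[e₂, e₃] = κ₂ e₃`,
`[e₁, e₂] = f₁ e₁ + f₂ e₂ - 2 σ e₃`. -/
structure IsIntegrabilityData (U : Set M) (e : Fin 3 → Π x : M, TangentSpace (𝓡 3) x)
    (f₁ f₂ κ₁ κ₂ σ : M → ℝ) : Prop where
  f₁_eq : ∀ x ∈ U, bracketCoeff e 0 1 0 x = f₁ x
  f₂_eq : ∀ x ∈ U, bracketCoeff e 0 1 1 x = f₂ x
  κ₁_eq : ∀ x ∈ U, bracketCoeff e 0 2 2 x = κ₁ x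
  κ₂_eq : ∀ x ∈ U, bracketCoeff e 1 2 2 x = κ₂ x
  σ_eq : ∀ x ∈ U, bracketCoeff e 0 1 2 x = -2 * σ x

end ThreeToTwo

/-- The derivative `X(u)` of a function along a vector field. -/
def lieDeriv {M : Type*} [TopologicalSpace M] [ChartedSpace (EuclideanSpace ℝ (Fin 3)) M]
    (X : Π x : M, TangentSpace (𝓡 3) x) (u : M → ℝ) (x : M) : ℝ :=
  mvfderiv (𝓡 3) u x (X x)

end FBiharmonic

end

noncomputable section
namespace FBiharmonic

open Filter Topology VectorField

section Calculus

theorem fderiv_lieBracket_apply {E F : Type*} [NormedAddCommGroup E] [NormedSpace ℝ E]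
    [NormedAddCommGroup F] [NormedSpace ℝ F] {u : E → F} {V W : E → E} {x : E}
    (hu : ContDiffAt ℝ 2 u x) (hV : DifferentiableAt ℝ V x) (hW : DifferentiableAt ℝ W x) :
    fderiv ℝ u x (lieBracket ℝ V W x)
      = fderiv ℝ (fun y => fderiv ℝ u y (W y)) x (V x)
        - fderiv ℝ (fun y => fderiv ℝ u y (V y)) x (W x) := by
  have hd : DifferentiableAt ℝ (fderiv ℝ u) x :=
    (hu.fderiv_right (m := 1) (by norm_num)).differentiableAt (by norm_num)
  have hs : IsSymmSndFDerivAt ℝ u x := hu.isSymmSndFDerivAt (by simp)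
  rw [fderiv_clm_apply hd hW, fderiv_clm_apply hd hV]
  simp [lieBracket, hs.eq (V x) (W x)]

variable {E : Type*} [NormedAddCommGroup E] [NormedSpace ℝ E]
  {H : Type*} [TopologicalSpace H] {I : ModelWithCorners ℝ E H}
  {M : Type*} [TopologicalSpace M] [ChartedSpace H M]
  {F : Type*} [NormedAddCommGroup F] [NormedSpace ℝ F]

theorem mvfderiv_congr {u u' : M → F} {x : M} (h : u =ᶠ[𝓝 x] u') :
    mvfderiv I u x = mvfderiv I u' x := by
  ext v
  simp only [mvfderiv, h.mfderiv_eq]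
  rfl

theorem mvfderiv_sum {ι : Type*} [Fintype ι] {u : ι → M → F} {x : M}
    (hu : ∀ i, MDiffAt (u i) x) :
    mvfderiv I (fun y => ∑ i, u i y) x = ∑ i, mvfderiv I (u i) x := by
  classical
  have key : ∀ s : Finset ι, MDiffAt (fun y => ∑ i ∈ s, u i y) x ∧
      mvfderiv I (fun y => ∑ i ∈ s, u i y) x = ∑ i ∈ s, mvfderiv I (u i) x := by
    intro s
    induction s using Finset.induction_on with
    | empty => exact ⟨by simpa using mdifferentiableAt_const, by simpa using mvfderiv_const (I := I) (0 : F)⟩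
    | insert a s ha ih =>
      simp only [Finset.sum_insert ha]
      refine ⟨(hu a).add ih.1, ?_⟩
      rw [← ih.2]
      exact mvfderiv_add (hu a) ih.1
  exact (key Finset.univ).2

theorem mvfderiv_clm_comp {F' : Type*} [NormedAddCommGroup F'] [NormedSpace ℝ F']
    (L : F →L[ℝ] F') {u : M → F} {x : M} (hu : MDiffAt u x) (v : TangentSpace I x) :
    mvfderiv I (fun y => L (u y)) x v = L (mvfderiv I u x v) := by
  have := mfderiv_comp_apply (I := I) (I' := 𝓘(ℝ, F)) (I'' := 𝓘(ℝ, F')) x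
    L.mdifferentiableAt hu v
  rw [L.mfderiv_eq] at this
  exact this

theorem mvfderiv_comp_mfderiv_apply {E' : Type*} [NormedAddCommGroup E'] [NormedSpace ℝ E']
    {H' : Type*} [TopologicalSpace H'] {J : ModelWithCorners ℝ E' H'}
    {N : Type*} [TopologicalSpace N] [ChartedSpace H' N] {φ : M → N} {u : N → F} {x : M}
    (hu : MDiffAt u (φ x)) (hφ : MDiffAt φ x) (v : TangentSpace I x) :
    mvfderiv I (fun y => u (φ y)) x v = mvfderiv J u (φ x) (mfderiv I J φ x v) :=
  mfderiv_comp_apply (I := I) (I' := J) (I'' := 𝓘(ℝ, F)) x hu hφ v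

variable [IsManifold I ∞ M]

theorem contMDiffAt_mvfderiv_apply {u : M → F} {Y : Π x : M, TangentSpace I x} {x : M}
    (hu : CMDiffAt ∞ u x) (hY : CMDiffAt ∞ (T% Y) x) :
    CMDiffAt ∞ (fun y => mvfderiv I u y (Y y)) x := by
  have : IsManifold I 1 M := IsManifold.of_le (n := ∞) (by norm_num)
  have h := ContMDiffAt.clm_apply_of_inCoordinates (IB₁ := I) (IB₂ := 𝓘(ℝ, F)) (IM := I)
    (E₁ := fun x : M => TangentSpace I x) (E₂ := fun z : F => TangentSpace 𝓘(ℝ, F) z)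
    (b₁ := fun y => y) (b₂ := u) (v := Y) (ϕ := fun y => mfderiv% u y) (n := ∞) (m₀ := x)
    (hu.mfderiv_const (m := ∞) le_rfl) hY hu
  exact (contMDiff_snd_tangentBundle_modelSpace F 𝓘(ℝ, F)).contMDiffAt.comp x h

variable [I.Boundaryless] [CompleteSpace E]

theorem mvfderiv_mlieBracket_apply {u : M → F} {X Y : Π x : M, TangentSpace I x} {x : M}
    (hu : CMDiffAt ∞ u x) (hX : CMDiffAt ∞ (T% X) x) (hY : CMDiffAt ∞ (T% Y) x) :
    mvfderiv I u x (mlieBracket I X Y x)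
      = mvfderiv I (fun y => mvfderiv I u y (Y y)) x (X x)
        - mvfderiv I (fun y => mvfderiv I u y (X y)) x (Y x) := by
  have : IsManifold I 1 M := IsManifold.of_le (n := ∞) (by norm_num)
  have : IsManifold I 2 M := IsManifold.of_le (n := ∞) (by norm_cast)
  set z := extChartAt I x x with hz
  set s := (extChartAt I x).symm with hs
  have hsz : s z = x := extChartAt_to_inv x
  have hzt : z ∈ (extChartAt I x).target := mem_extChartAt_target x
  have hu2 : ContDiffAt ℝ 2 (u ∘ s) z := by
    have h1 : CMDiffAt ∞ (u ∘ s) z :=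
      ContMDiffAt.comp z (by rw [hsz]; exact hu)
        ((contMDiffOn_extChartAt_symm x).contMDiffAt (extChartAt_target_mem_nhds x))
    exact h1.contDiffAt.of_le (by norm_cast)
  have hmd : ∀ w ∈ (extChartAt I x).target, MDiffAt s w := fun w hw => by
    have := mdifferentiableWithinAt_extChartAt_symm (I := I) hw
    rwa [I.range_eq_univ, mdifferentiableWithinAt_univ] at this
  obtain ⟨P, hP⟩ : ∃ P : (Π x : M, TangentSpace I x) → E → E,
      ∀ Z, P Z = mpullbackWithin 𝓘(ℝ, E) I s Z (range I) := ⟨_, fun _ => rfl⟩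
  have hd : ∀ Z : Π x : M, TangentSpace I x, CMDiffAt ∞ (T% Z) x →
      DifferentiableAt ℝ (P Z) z := fun Z hZ => by
    have := (hZ.mdifferentiableAt (by simp)).mdifferentiableWithinAt
      (s := univ) |>.differentiableWithinAt_mpullbackWithin_vectorField
    rw [preimage_univ, univ_inter] at this
    rw [hP]
    exact this.differentiableAt (by rw [I.range_eq_univ]; exact univ_mem)
  have hpt : ∀ Z : Π x : M, TangentSpace I x, P Z z = Z x := fun Z => by
    have h := mfderivWithin_extChartAt_symm_inverse_apply (I := I) (x := x) (Z x)
    rw [hP, ← h]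
    change (mfderivWithin 𝓘(ℝ, E) I s (range I) z).inverse (Z (s z)) = _
    congr 1
    rw [hsz]
  have hder : ∀ (g : M → F) (v : E), MDiffAt g x →
      fderiv ℝ (fun y => g (s y)) z v = mvfderiv I g x v := fun g v hg => by
    rw [hg.mvfderiv, I.range_eq_univ, fderivWithin_univ]
    rfl
  have hpull : ∀ Z : Π x : M, TangentSpace I x,
      (fun w => fderiv ℝ (u ∘ s) w (P Z w)) =ᶠ[𝓝 z]
        fun w => mvfderiv I u (s w) (Z (s w)) := fun Z => by
    have hsm : CMDiffAt ∞ s z :=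
      (contMDiffOn_extChartAt_symm x).contMDiffAt (extChartAt_target_mem_nhds x)
    have hun : ∀ᶠ y in 𝓝 x, CMDiffAt 1 u y :=
      (contMDiffAt_iff_contMDiffAt_nhds (by simp)).1 (hu.of_le (by norm_num))
    have hun' : ∀ᶠ w in 𝓝 z, CMDiffAt 1 u (s w) :=
      (hsz ▸ hsm.continuousAt.tendsto : Tendsto s (𝓝 z) (𝓝 x)).eventually hun
    filter_upwards [hun', extChartAt_target_mem_nhds (I := I) x] with w hw hwt
    have hinv := isInvertible_mfderivWithin_extChartAt_symm (I := I) hwt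
    have h1 : mfderivWithin 𝓘(ℝ, E) I s (range I) w = mfderiv 𝓘(ℝ, E) I s w := by
      rw [I.range_eq_univ, mfderivWithin_univ]
    have h2 := mvfderiv_comp_mfderiv_apply (hw.mdifferentiableAt (by simp)) (hmd w hwt)
      (P Z w : TangentSpace 𝓘(ℝ, E) w)
    have h3 : mfderiv 𝓘(ℝ, E) I s w (P Z w : TangentSpace 𝓘(ℝ, E) w) = Z (s w) := by
      rw [hP, mpullbackWithin_apply, ← h1]
      exact hinv.self_apply_inverse _
    rw [h3] at h2
    rw [← h2, mvfderiv, mfderiv_eq_fderiv]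
    rfl
  have hbr : mlieBracket I X Y x = lieBracket ℝ (P X) (P Y) z := by
    have hid : ∀ w : E, (ContinuousLinearMap.id ℝ E).inverse w = w := fun w => by
      rw [ContinuousLinearMap.inverse_id]; rfl
    rw [mlieBracket, mlieBracketWithin_apply, mfderiv_extChartAt_self]
    refine (hid _).trans ?_
    rw [preimage_univ, univ_inter, ← hP, ← hP, I.range_eq_univ]
    exact congrFun lieBracketWithin_univ z
  have key := fderiv_lieBracket_apply hu2 (hd X hX) (hd Y hY)
  rw [(hpull X).fderiv_eq, (hpull Y).fderiv_eq, hpt, hpt] at key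
  rw [hbr, ← hder u _ (hu.mdifferentiableAt (by simp))]
  exact key.trans (congrArg₂ (· - ·)
    (hder _ _ ((contMDiffAt_mvfderiv_apply hu hY).mdifferentiableAt (by simp)))
    (hder _ _ ((contMDiffAt_mvfderiv_apply hu hX).mdifferentiableAt (by simp))))

variable {E' : Type*} [NormedAddCommGroup E'] [NormedSpace ℝ E'] [CompleteSpace E']
  {H' : Type*} [TopologicalSpace H'] {J : ModelWithCorners ℝ E' H'} [J.Boundaryless]
  {N : Type*} [TopologicalSpace N] [ChartedSpace H' N] [IsManifold J ∞ N]

/-- Lie brackets of `φ`-related vector fields are `φ`-related. -/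
theorem mfderiv_mlieBracket_of_related {φ : M → N} {X Y : Π x : M, TangentSpace I x}
    {X' Y' : Π q : N, TangentSpace J q} {x : M} (hφ : CMDiffAt ∞ φ x)
    (hX : CMDiffAt ∞ (T% X) x) (hY : CMDiffAt ∞ (T% Y) x)
    (hX' : CMDiffAt ∞ (T% X') (φ x)) (hY' : CMDiffAt ∞ (T% Y') (φ x))
    (hXX' : ∀ᶠ y in 𝓝 x, mfderiv I J φ y (X y) = X' (φ y))
    (hYY' : ∀ᶠ y in 𝓝 x, mfderiv I J φ y (Y y) = Y' (φ y)) :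
    mfderiv I J φ x (mlieBracket I X Y x) = mlieBracket J X' Y' (φ x) := by
  have : IsManifold J 1 N := IsManifold.of_le (n := ∞) (by norm_num)
  set c := extChartAt J (φ x) with hc
  have hcs : CMDiffAt ∞ c (φ x) := contMDiffAt_extChartAt
  have hφ1 : ∀ᶠ y in 𝓝 x, MDiffAt φ y := by
    filter_upwards [(contMDiffAt_iff_contMDiffAt_nhds (n := 1) (by simp)).1
      (hφ.of_le (by norm_num))] with y hy using hy.mdifferentiableAt (by simp)
  have hc1 : ∀ᶠ y in 𝓝 x, MDiffAt c (φ y) := by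
    have := (contMDiffAt_iff_contMDiffAt_nhds (n := 1) (by simp)).1 (hcs.of_le (by norm_num))
    filter_upwards [hφ.continuousAt.eventually this] with y hy using
      hy.mdifferentiableAt (by simp)
  have hrel : ∀ (Z : Π x : M, TangentSpace I x) (Z' : Π q : N, TangentSpace J q),
      (∀ᶠ y in 𝓝 x, mfderiv I J φ y (Z y) = Z' (φ y)) →
      (fun y => mvfderiv I (fun y => c (φ y)) y (Z y)) =ᶠ[𝓝 x]
        fun y => mvfderiv J c (φ y) (Z' (φ y)) := fun Z Z' h => by
    filter_upwards [h, hφ1, hc1] with y hy h1 h2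
    rw [mvfderiv_comp_mfderiv_apply h2 h1, hy]
  have e1 := mvfderiv_mlieBracket_apply (u := fun y => c (φ y)) (hcs.comp x hφ) hX hY
  have e2 := mvfderiv_mlieBracket_apply hcs hX' hY'
  have d1 := (contMDiffAt_mvfderiv_apply hcs hX').mdifferentiableAt (by simp)
  have d2 := (contMDiffAt_mvfderiv_apply hcs hY').mdifferentiableAt (by simp)
  have key : mvfderiv J c (φ x) (mfderiv I J φ x (mlieBracket I X Y x))
      = mvfderiv J c (φ x) (mlieBracket J X' Y' (φ x)) := by
    rw [← mvfderiv_comp_mfderiv_apply hc1.self_of_nhds hφ1.self_of_nhds, e2]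
    refine e1.trans ?_
    rw [mvfderiv_congr (hrel X X' hXX'), mvfderiv_congr (hrel Y Y' hYY'),
      mvfderiv_comp_mfderiv_apply d1 hφ1.self_of_nhds,
      mvfderiv_comp_mfderiv_apply d2 hφ1.self_of_nhds,
      hXX'.self_of_nhds, hYY'.self_of_nhds]
  have hinj : Function.Injective (mvfderiv J c (φ x)) :=
    (isInvertible_mfderiv_extChartAt (I := J) (mem_extChartAt_source (φ x))).injective
  exact hinj key

end Calculus

section LeviCivita

variable {E : Type*} [NormedAddCommGroup E] [NormedSpace ℝ E]
  {H : Type*} [TopologicalSpace H] {I : ModelWithCorners ℝ E H}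
  {M : Type*} [TopologicalSpace M] [ChartedSpace H M]
  [IsManifold I ∞ M]

theorem mdifferentiableAt_smul_vectorField {f : M → ℝ} {X : Π x : M, TangentSpace I x} {x : M}
    (hf : MDiffAt f x) (hX : MDiffAt (T% X) x) : MDiffAt (T% (fun y => f y • X y)) x :=
  hf.smul_section hX

theorem contMDiffAt_extendVec {x : M} (v : TangentSpace I x) :
    CMDiffAt ∞ (T% (extendVec I v)) x :=
  FiberBundle.contMDiffAt_extend I E v

theorem mdifferentiableAt_extendVec {x : M} (v : TangentSpace I x) :
    MDiffAt (T% (extendVec I v)) x :=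
  (contMDiffAt_extendVec v).mdifferentiableAt (by simp)

@[simp] theorem extendVec_self {x : M} (v : TangentSpace I x) : extendVec I v x = v :=
  FiberBundle.extend_apply_self E (E := fun y : M => TangentSpace I y) v

variable [RiemannianBundle (fun x : M => TangentSpace I x)]
  [IsContMDiffRiemannianBundle I ∞ E (fun x : M => TangentSpace I x)]

theorem mdifferentiableAt_inner {X Y : Π x : M, TangentSpace I x} {x : M}
    (hX : MDiffAt (T% X) x) (hY : MDiffAt (T% Y) x) : MDiffAt (fun y => ⟪X y, Y y⟫) x :=
  MDifferentiableAt.inner_bundle (F := E) (E := fun x : M => TangentSpace I x) hX hY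

theorem contMDiffAt_inner {X Y : Π x : M, TangentSpace I x} {x : M}
    (hX : CMDiffAt ∞ (T% X) x) (hY : CMDiffAt ∞ (T% Y) x) :
    CMDiffAt ∞ (fun y => ⟪X y, Y y⟫) x :=
  ContMDiffAt.inner_bundle (F := E) (E := fun x : M => TangentSpace I x) hX hY

theorem mvfderiv_inner_smul_left {f : M → ℝ} {X Y : Π x : M, TangentSpace I x} {x : M}
    (hf : MDiffAt f x) (hX : MDiffAt (T% X) x) (hY : MDiffAt (T% Y) x) (v : TangentSpace I x) :
    mvfderiv I (fun y => ⟪(f • X) y, Y y⟫) x v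
      = f x * mvfderiv I (fun y => ⟪X y, Y y⟫) x v + mvfderiv I f x v * ⟪X x, Y x⟫ := by
  have : (fun y => ⟪(f • X) y, Y y⟫) = f * fun y => ⟪X y, Y y⟫ := by
    ext y; simp [real_inner_smul_left]
  rw [this, mvfderiv_mul hf (mdifferentiableAt_inner hX hY)]
  simp [mul_comm]

theorem mvfderiv_inner_smul_right {f : M → ℝ} {X Y : Π x : M, TangentSpace I x} {x : M}
    (hf : MDiffAt f x) (hX : MDiffAt (T% X) x) (hY : MDiffAt (T% Y) x) (v : TangentSpace I x) :
    mvfderiv I (fun y => ⟪X y, (f • Y) y⟫) x v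
      = f x * mvfderiv I (fun y => ⟪X y, Y y⟫) x v + mvfderiv I f x v * ⟪X x, Y x⟫ := by
  have : (fun y => ⟪X y, (f • Y) y⟫) = fun y => ⟪(f • Y) y, X y⟫ := by
    ext y; exact real_inner_comm _ _
  rw [this, mvfderiv_inner_smul_left hf hY hX]
  simp [real_inner_comm]

theorem mvfderiv_inner_add_left {X X' Y : Π x : M, TangentSpace I x} {x : M}
    (hX : MDiffAt (T% X) x) (hX' : MDiffAt (T% X') x) (hY : MDiffAt (T% Y) x)
    (v : TangentSpace I x) :
    mvfderiv I (fun y => ⟪(X + X') y, Y y⟫) x v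
      = mvfderiv I (fun y => ⟪X y, Y y⟫) x v + mvfderiv I (fun y => ⟪X' y, Y y⟫) x v := by
  have : (fun y => ⟪(X + X') y, Y y⟫) = (fun y => ⟪X y, Y y⟫) + fun y => ⟪X' y, Y y⟫ := by
    ext y; simp [inner_add_left]
  rw [this, mvfderiv_add (mdifferentiableAt_inner hX hY) (mdifferentiableAt_inner hX' hY)]
  rfl

theorem mvfderiv_inner_add_right {X Y Y' : Π x : M, TangentSpace I x} {x : M}
    (hX : MDiffAt (T% X) x) (hY : MDiffAt (T% Y) x) (hY' : MDiffAt (T% Y') x)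
    (v : TangentSpace I x) :
    mvfderiv I (fun y => ⟪X y, (Y + Y') y⟫) x v
      = mvfderiv I (fun y => ⟪X y, Y y⟫) x v + mvfderiv I (fun y => ⟪X y, Y' y⟫) x v := by
  have : (fun y => ⟪X y, (Y + Y') y⟫) = (fun y => ⟪X y, Y y⟫) + fun y => ⟪X y, Y' y⟫ := by
    ext y; simp [inner_add_right]
  rw [this, mvfderiv_add (mdifferentiableAt_inner hX hY) (mdifferentiableAt_inner hX hY')]
  rfl

variable [FiniteDimensional ℝ E]

theorem tensorialAt_koszul_left {Y Z : Π x : M, TangentSpace I x} {x : M}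
    (hY : MDiffAt (T% Y) x) (hZ : MDiffAt (T% Z) x) :
    TensorialAt I E (fun X : Π x : M, TangentSpace I x => koszul I X Y Z x) x where
  smul {f X} hf hX := by
    have : IsManifold I 2 M := IsManifold.of_le (n := ∞) (by norm_cast)
    simp only [koszul]
    rw [mvfderiv_inner_smul_left hf hX hZ, mvfderiv_inner_smul_left hf hX hY,
      mlieBracket_smul_left hf hX, mlieBracket_smul_left hf hX]
    simp only [Pi.smul_apply', map_smul, inner_add_left, inner_neg_left, real_inner_smul_left,
      real_inner_smul_right, smul_eq_mul, neg_smul]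
    ring
  add {X X'} hX hX' := by
    have : IsManifold I 2 M := IsManifold.of_le (n := ∞) (by norm_cast)
    simp only [koszul]
    rw [mvfderiv_inner_add_left hX hX' hZ, mvfderiv_inner_add_left hX hX' hY,
      mlieBracket_add_left hX hX', mlieBracket_add_left hX hX']
    simp only [Pi.add_apply, map_add, inner_add_left, inner_add_right]
    ring

theorem tensorialAt_koszul_right {X Y : Π x : M, TangentSpace I x} {x : M}
    (hX : MDiffAt (T% X) x) (hY : MDiffAt (T% Y) x) :
    TensorialAt I E (fun Z : Π x : M, TangentSpace I x => koszul I X Y Z x) x where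
  smul {f Z} hf hZ := by
    have : IsManifold I 2 M := IsManifold.of_le (n := ∞) (by norm_cast)
    simp only [koszul]
    rw [mvfderiv_inner_smul_right hf hY hZ, mvfderiv_inner_smul_right hf hX hZ,
      mlieBracket_smul_right hf hZ, mlieBracket_smul_right hf hZ]
    simp only [Pi.smul_apply', map_smul, inner_add_left, real_inner_smul_left,
      real_inner_smul_right, smul_eq_mul]
    rw [real_inner_comm (Y x) (Z x), real_inner_comm (X x) (Z x)]
    ring
  add {Z Z'} hZ hZ' := by
    have : IsManifold I 2 M := IsManifold.of_le (n := ∞) (by norm_cast)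
    simp only [koszul]
    rw [mvfderiv_inner_add_right hY hZ hZ', mvfderiv_inner_add_right hX hZ hZ',
      mlieBracket_add_right hZ hZ', mlieBracket_add_right hZ hZ']
    simp only [Pi.add_apply, map_add, inner_add_left, inner_add_right]
    ring

/-- The right-hand side of the Koszul formula as a bilinear form in the outer arguments. -/
def koszulForm (Y : Π x : M, TangentSpace I x) (x : M) (hY : MDiffAt (T% Y) x) :
    TangentSpace I x →L[ℝ] TangentSpace I x →L[ℝ] ℝ :=
  TensorialAt.mkHom₂ (fun X Z => koszul I X Y Z x) x
    (fun _ hZ => tensorialAt_koszul_left hY hZ) (fun _ hX => tensorialAt_koszul_right hX hY)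

theorem koszulForm_apply {X Y Z : Π x : M, TangentSpace I x} {x : M} (hX : MDiffAt (T% X) x)
    (hY : MDiffAt (T% Y) x) (hZ : MDiffAt (T% Z) x) :
    koszulForm Y x hY (X x) (Z x) = koszul I X Y Z x :=
  TensorialAt.mkHom₂_apply _ _ hX hZ

theorem inner_leviCivita_eq_koszulForm {Y : Π x : M, TangentSpace I x} {x : M}
    (hY : MDiffAt (T% Y) x) (v w : TangentSpace I x) :
    ⟪leviCivita I Y x v, w⟫ = koszulForm Y x hY v w := by
  have h : ∀ i, koszul I (extendVec I v) Y (extendVec I (onb I x i)) x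
      = koszulForm Y x hY v (onb I x i) := fun i => by
    rw [← koszulForm_apply (mdifferentiableAt_extendVec v) hY (mdifferentiableAt_extendVec _)]
    simp
  conv_rhs => rw [← (onb I x).sum_repr' w]
  simp only [leviCivita, sum_inner, map_sum, map_smul, real_inner_smul_left, smul_eq_mul, h]
  exact Finset.sum_congr rfl fun i _ => mul_comm _ _

theorem inner_leviCivita {X Y Z : Π x : M, TangentSpace I x} {x : M} (hX : MDiffAt (T% X) x)
    (hY : MDiffAt (T% Y) x) (hZ : MDiffAt (T% Z) x) :
    ⟪leviCivita I Y x (X x), Z x⟫ = koszul I X Y Z x := by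
  rw [inner_leviCivita_eq_koszulForm hY, koszulForm_apply hX hY hZ]

theorem leviCivita_apply_add {Y : Π x : M, TangentSpace I x} {x : M} (hY : MDiffAt (T% Y) x)
    (v w : TangentSpace I x) :
    leviCivita I Y x (v + w) = leviCivita I Y x v + leviCivita I Y x w := by
  refine ext_inner_right ℝ fun z => ?_
  simp [inner_add_left, inner_leviCivita_eq_koszulForm hY]

theorem leviCivita_apply_smul {Y : Π x : M, TangentSpace I x} {x : M} (hY : MDiffAt (T% Y) x)
    (c : ℝ) (v : TangentSpace I x) :
    leviCivita I Y x (c • v) = c • leviCivita I Y x v := by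
  refine ext_inner_right ℝ fun z => ?_
  simp [real_inner_smul_left, inner_leviCivita_eq_koszulForm hY]

/-- `v ↦ ∇_v Y` as a linear map. -/
def leviCivitaHom (Y : Π x : M, TangentSpace I x) (x : M) (hY : MDiffAt (T% Y) x) :
    TangentSpace I x →ₗ[ℝ] TangentSpace I x where
  toFun := leviCivita I Y x
  map_add' := leviCivita_apply_add hY
  map_smul' := leviCivita_apply_smul hY

@[simp] theorem leviCivitaHom_apply {Y : Π x : M, TangentSpace I x} {x : M}
    (hY : MDiffAt (T% Y) x) (v : TangentSpace I x) :
    leviCivitaHom Y x hY v = leviCivita I Y x v := rfl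

omit [IsContMDiffRiemannianBundle I ∞ E (fun x : M => TangentSpace I x)] in
theorem leviCivita_congr {Y Y' : Π x : M, TangentSpace I x} {x : M}
    (h : ∀ᶠ y in 𝓝 x, Y y = Y' y) (v : TangentSpace I x) :
    leviCivita I Y x v = leviCivita I Y' x v := by
  have h1 : ∀ Z : Π x : M, TangentSpace I x,
      (fun y => ⟪Y y, Z y⟫) =ᶠ[𝓝 x] fun y => ⟪Y' y, Z y⟫ := fun Z => by
    filter_upwards [h] with y hy using by rw [hy]
  have h2 : ∀ Z : Π x : M, TangentSpace I x,
      (fun y => ⟪Z y, Y y⟫) =ᶠ[𝓝 x] fun y => ⟪Z y, Y' y⟫ := fun Z => by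
    filter_upwards [h] with y hy using by rw [hy]
  have h3 : ∀ Z : Π x : M, TangentSpace I x, mlieBracket I Z Y x = mlieBracket I Z Y' x :=
    fun Z => Filter.EventuallyEq.mlieBracket_vectorField_eq EventuallyEq.rfl h
  have h4 : ∀ Z : Π x : M, TangentSpace I x, mlieBracket I Y Z x = mlieBracket I Y' Z x :=
    fun Z => Filter.EventuallyEq.mlieBracket_vectorField_eq h EventuallyEq.rfl
  simp only [leviCivita, koszul]
  refine Finset.sum_congr rfl fun i _ => ?_
  rw [mvfderiv_congr (h1 _), mvfderiv_congr (h2 _), h.self_of_nhds, h3, h4]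

theorem leviCivita_add {Y Y' : Π x : M, TangentSpace I x} {x : M}
    (hY : MDiffAt (T% Y) x) (hY' : MDiffAt (T% Y') x) (v : TangentSpace I x) :
    leviCivita I (Y + Y') x v = leviCivita I Y x v + leviCivita I Y' x v := by
  have : IsManifold I 2 M := IsManifold.of_le (n := ∞) (by norm_cast)
  have hs : MDiffAt (T% (Y + Y')) x := mdifferentiableAt_add_section hY hY'
  refine ext_inner_right ℝ fun z => ?_
  have e := fun (W : Π x : M, TangentSpace I x) (hW : MDiffAt (T% W) x) =>
    inner_leviCivita (mdifferentiableAt_extendVec v) hW (mdifferentiableAt_extendVec z)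
  have hv := mdifferentiableAt_extendVec v
  have hz := mdifferentiableAt_extendVec z
  simp only [extendVec_self] at e
  rw [inner_add_left, e _ hs, e _ hY, e _ hY']
  simp only [koszul]
  rw [mvfderiv_inner_add_left hY hY' hz, mvfderiv_inner_add_right hv hY hY',
      mlieBracket_add_left hY hY', mlieBracket_add_right hY hY']
  simp only [Pi.add_apply, map_add, inner_add_left, inner_add_right]
  ring

theorem leviCivita_smul {f : M → ℝ} {Y : Π x : M, TangentSpace I x} {x : M}
    (hf : MDiffAt f x) (hY : MDiffAt (T% Y) x) (v : TangentSpace I x) :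
    leviCivita I (f • Y) x v = mvfderiv I f x v • Y x + f x • leviCivita I Y x v := by
  have : IsManifold I 2 M := IsManifold.of_le (n := ∞) (by norm_cast)
  have hs : MDiffAt (T% (f • Y)) x := hf.smul_section hY
  refine ext_inner_right ℝ fun z => ?_
  have e := fun (W : Π x : M, TangentSpace I x) (hW : MDiffAt (T% W) x) =>
    inner_leviCivita (mdifferentiableAt_extendVec v) hW (mdifferentiableAt_extendVec z)
  have hv := mdifferentiableAt_extendVec v
  have hz := mdifferentiableAt_extendVec z
  simp only [extendVec_self] at e
  rw [inner_add_left, real_inner_smul_left, real_inner_smul_left, e _ hs, e _ hY]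
  simp only [koszul]
  rw [mvfderiv_inner_smul_left hf hY hz, mvfderiv_inner_smul_right hf hv hY,
      mlieBracket_smul_left hf hY, mlieBracket_smul_right hf hY]
  simp only [Pi.smul_apply', map_smul, inner_add_left, inner_neg_left, real_inner_smul_left,
      real_inner_smul_right, smul_eq_mul, neg_smul, extendVec_self]
  rw [real_inner_comm (Y x) v]
  ring

theorem leviCivita_sum {ι : Type*} [Fintype ι] {Y : ι → Π x : M, TangentSpace I x} {x : M}
    (hY : ∀ i, MDiffAt (T% (Y i)) x) (v : TangentSpace I x) :
    leviCivita I (fun y => ∑ i, Y i y) x v = ∑ i, leviCivita I (Y i) x v := by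
  classical
  have key : ∀ s : Finset ι,
      leviCivita I (fun y => ∑ i ∈ s, Y i y) x v = ∑ i ∈ s, leviCivita I (Y i) x v := by
    intro s
    induction s using Finset.induction_on with
    | empty =>
      simp only [Finset.sum_empty]
      have := leviCivita_smul (f := fun _ => 0) (v := v) mdifferentiableAt_const
        (mdifferentiableAt_extendVec (0 : TangentSpace I x))
      have h0 : (fun _ : M => (0 : ℝ)) • extendVec I (0 : TangentSpace I x) = fun _ => 0 :=
        funext fun y => zero_smul ℝ _
      simpa [mvfderiv_const, h0] using this
    | insert a s ha ih =>
      simp only [Finset.sum_insert ha]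
      rw [← ih]
      exact leviCivita_add (hY a) (.sum_section fun i _ => hY i) v
  exact key Finset.univ

theorem leviCivita_sum_smul {ι : Type*} [Fintype ι] {c : ι → M → ℝ}
    {Y : ι → Π x : M, TangentSpace I x} {x : M} (hc : ∀ i, MDiffAt (c i) x)
    (hY : ∀ i, MDiffAt (T% (Y i)) x) (v : TangentSpace I x) :
    leviCivita I (fun y => ∑ i, c i y • Y i y) x v
      = ∑ i, (mvfderiv I (c i) x v • Y i x + c i x • leviCivita I (Y i) x v) := by
  rw [leviCivita_sum fun i => mdifferentiableAt_smul_vectorField (hc i) (hY i)]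
  exact Finset.sum_congr rfl fun i _ => leviCivita_smul (hc i) (hY i) v

theorem leviCivita_torsion {X Y : Π x : M, TangentSpace I x} {x : M}
    (hX : MDiffAt (T% X) x) (hY : MDiffAt (T% Y) x) :
    leviCivita I Y x (X x) - leviCivita I X x (Y x) = mlieBracket I X Y x := by
  refine ext_inner_right ℝ fun z => ?_
  have hz := mdifferentiableAt_extendVec z
  have e1 := inner_leviCivita hX hY hz
  have e2 := inner_leviCivita hY hX hz
  simp only [extendVec_self] at e1 e2
  have h3 : (fun y => ⟪X y, Y y⟫) = fun y => ⟪Y y, X y⟫ := by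
    ext y; exact real_inner_comm _ _
  rw [inner_sub_left, e1, e2]
  simp only [koszul, h3, extendVec_self]
  rw [mlieBracket_swap_apply (V := Y) (W := X), inner_neg_left]
  ring

end LeviCivita

section OrthonormalTrace

variable {V : Type*} [NormedAddCommGroup V] [InnerProductSpace ℝ V] [FiniteDimensional ℝ V]
  {ι : Type*} [Fintype ι] {e : ι → V}

theorem sum_inner_smul_of_orthonormal (he : Orthonormal ℝ e)
    (hc : Fintype.card ι = Module.finrank ℝ V) (w : V) : ∑ i, ⟪e i, w⟫ • e i = w := by
  have hb := (OrthonormalBasis.mk he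
    (he.linearIndependent.span_eq_top_of_card_eq_finrank' hc).ge).sum_repr' w
  simpa using hb

theorem sum_inner_mul_inner_of_orthonormal (he : Orthonormal ℝ e)
    (hc : Fintype.card ι = Module.finrank ℝ V) (v w : V) :
    ∑ i, ⟪e i, v⟫ * ⟪e i, w⟫ = ⟪v, w⟫ := by
  conv_rhs => rw [← sum_inner_smul_of_orthonormal he hc v]
  simp [sum_inner, real_inner_smul_left]

theorem ext_inner_of_orthonormal (he : Orthonormal ℝ e)
    (hc : Fintype.card ι = Module.finrank ℝ V) {v w : V} (h : ∀ i, ⟪v, e i⟫ = ⟪w, e i⟫) :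
    v = w := by
  rw [← sum_inner_smul_of_orthonormal he hc v, ← sum_inner_smul_of_orthonormal he hc w]
  simp only [real_inner_comm _ (e _), h]

theorem sum_apply_apply_of_orthonormal {κ F : Type*} [Fintype κ] [AddCommGroup F] [Module ℝ F]
    (S : V →ₗ[ℝ] V →ₗ[ℝ] F) (b : OrthonormalBasis κ ℝ V) (he : Orthonormal ℝ e)
    (hc : Fintype.card ι = Module.finrank ℝ V) :
    ∑ i, S (b i) (b i) = ∑ j, S (e j) (e j) := by
  classical
  have h1 : ∀ i, S (b i) (b i) = ∑ j, ∑ k, (⟪b i, e j⟫ * ⟪b i, e k⟫) • S (e j) (e k) := fun i => by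
    conv_lhs => rw [← sum_inner_smul_of_orthonormal he hc (b i)]
    simp only [map_sum, map_smul, LinearMap.sum_apply, LinearMap.smul_apply, Finset.smul_sum,
      smul_smul, real_inner_comm (b i)]
    rw [Finset.sum_comm]
    simp only [mul_comm]
  simp only [h1]
  rw [Finset.sum_comm]
  refine Finset.sum_congr rfl fun j _ => ?_
  rw [Finset.sum_comm]
  simp only [← Finset.sum_smul,
    sum_inner_mul_inner_of_orthonormal b.orthonormal (Module.finrank_eq_card_basis b.toBasis).symm,
    orthonormal_iff_ite.1 he, ite_smul, one_smul, zero_smul, Finset.sum_ite_eq, Finset.mem_univ,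
    if_true]

end OrthonormalTrace

section Frames

variable {E : Type*} [NormedAddCommGroup E] [NormedSpace ℝ E] [FiniteDimensional ℝ E]
  {H : Type*} [TopologicalSpace H] {I : ModelWithCorners ℝ E H}
  {M : Type*} [TopologicalSpace M] [ChartedSpace H M]
  [IsManifold I ∞ M] [RiemannianBundle (fun x : M => TangentSpace I x)]
  [IsContMDiffRiemannianBundle I ∞ E (fun x : M => TangentSpace I x)]
  {ι : Type*} [Fintype ι] {e : ι → Π x : M, TangentSpace I x} {x : M}

omit [IsManifold I ∞ M] [IsContMDiffRiemannianBundle I ∞ E (fun x : M => TangentSpace I x)] in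
theorem eventually_eq_sum_inner_smul (ho : ∀ᶠ y in 𝓝 x, Orthonormal ℝ (fun i => e i y))
    (hc : Fintype.card ι = Module.finrank ℝ E) (Y : Π x : M, TangentSpace I x) :
    ∀ᶠ y in 𝓝 x, Y y = ∑ i, ⟪e i y, Y y⟫ • e i y := by
  filter_upwards [ho] with y hy using (sum_inner_smul_of_orthonormal hy hc _).symm

theorem mdifferentiableAt_oneForm_apply (he : ∀ i, MDiffAt (T% (e i)) x)
    (ho : ∀ᶠ y in 𝓝 x, Orthonormal ℝ (fun i => e i y))
    (hc : Fintype.card ι = Module.finrank ℝ E) {θ : Π y : M, TangentSpace I y →ₗ[ℝ] ℝ}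
    (hθ : ∀ i, MDiffAt (fun y => θ y (e i y)) x) {Y : Π x : M, TangentSpace I x}
    (hY : MDiffAt (T% Y) x) : MDiffAt (fun y => θ y (Y y)) x := by
  have h : (fun y => θ y (Y y)) =ᶠ[𝓝 x] fun y => ∑ i, ⟪e i y, Y y⟫ * θ y (e i y) := by
    filter_upwards [eventually_eq_sum_inner_smul ho hc Y] with y hy
    conv_lhs => rw [hy]
    simp
  refine MDifferentiableAt.congr_of_eventuallyEq ?_ h
  have := fun i => (mdifferentiableAt_inner (he i) hY).mul (hθ i)
  classical
  have key : ∀ s : Finset ι, MDiffAt (fun y => ∑ i ∈ s, ⟪e i y, Y y⟫ * θ y (e i y)) x := by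
    intro s
    induction s using Finset.induction_on with
    | empty => simpa using mdifferentiableAt_const
    | insert a s ha ih =>
      simp only [Finset.sum_insert ha]
      exact (this a).add ih
  exact key _

theorem tensorialAt_covDerivOneForm (he : ∀ i, MDiffAt (T% (e i)) x)
    (ho : ∀ᶠ y in 𝓝 x, Orthonormal ℝ (fun i => e i y))
    (hc : Fintype.card ι = Module.finrank ℝ E) {θ : Π y : M, TangentSpace I y →ₗ[ℝ] ℝ}
    (hθ : ∀ i, MDiffAt (fun y => θ y (e i y)) x) (v : TangentSpace I x) :
    TensorialAt I E (fun Y : Π x : M, TangentSpace I x =>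
      mvfderiv I (fun y => θ y (Y y)) x v - θ x (leviCivita I Y x v)) x where
  smul {f Y} hf hY := by
    have h : (fun y => θ y ((f • Y) y)) = f * fun y => θ y (Y y) := by
      ext y; simp
    rw [leviCivita_smul hf hY, h, mvfderiv_mul hf (mdifferentiableAt_oneForm_apply he ho hc hθ hY)]
    simp
    ring
  add {Y Y'} hY hY' := by
    have h : (fun y => θ y ((Y + Y') y)) = (fun y => θ y (Y y)) + fun y => θ y (Y' y) := by
      ext y; simp
    rw [leviCivita_add hY hY', h, mvfderiv_add (mdifferentiableAt_oneForm_apply he ho hc hθ hY)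
      (mdifferentiableAt_oneForm_apply he ho hc hθ hY')]
    simp
    ring

/-- The covariant derivative `(v, w) ↦ (∇_v θ)(w)` of a one-form `θ` at a point. -/
def covDerivOneForm (he : ∀ i, MDiffAt (T% (e i)) x)
    (ho : ∀ᶠ y in 𝓝 x, Orthonormal ℝ (fun i => e i y))
    (hc : Fintype.card ι = Module.finrank ℝ E) {θ : Π y : M, TangentSpace I y →ₗ[ℝ] ℝ}
    (hθ : ∀ i, MDiffAt (fun y => θ y (e i y)) x) :
    TangentSpace I x →ₗ[ℝ] TangentSpace I x →ₗ[ℝ] ℝ :=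
  LinearMap.mk₂ ℝ
    (fun v w => TensorialAt.mkHom _ x (tensorialAt_covDerivOneForm he ho hc hθ v) w)
    (fun v v' w => by
      simp only [TensorialAt.mkHom_apply_eq_extend, map_add,
        leviCivita_apply_add (FiberBundle.mdifferentiableAt_extend I E w)]
      ring)
    (fun c v w => by
      simp only [TensorialAt.mkHom_apply_eq_extend, map_smul, smul_eq_mul,
        leviCivita_apply_smul (FiberBundle.mdifferentiableAt_extend I E w)]
      ring)
    (fun v w w' => map_add _ w w')
    (fun c v w => map_smul _ c w)

theorem covDerivOneForm_apply (he : ∀ i, MDiffAt (T% (e i)) x)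
    (ho : ∀ᶠ y in 𝓝 x, Orthonormal ℝ (fun i => e i y))
    (hc : Fintype.card ι = Module.finrank ℝ E) {θ : Π y : M, TangentSpace I y →ₗ[ℝ] ℝ}
    (hθ : ∀ i, MDiffAt (fun y => θ y (e i y)) x) (v : TangentSpace I x)
    {Y : Π x : M, TangentSpace I x} (hY : MDiffAt (T% Y) x) :
    covDerivOneForm he ho hc hθ v (Y x)
      = mvfderiv I (fun y => θ y (Y y)) x v - θ x (leviCivita I Y x v) :=
  TensorialAt.mkHom_apply (tensorialAt_covDerivOneForm he ho hc hθ v) hY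

/-- The divergence of a one-form may be computed in any local orthonormal frame. -/
theorem divergence_eq_sum_frame (he : ∀ i, MDiffAt (T% (e i)) x)
    (ho : ∀ᶠ y in 𝓝 x, Orthonormal ℝ (fun i => e i y))
    (hc : Fintype.card ι = Module.finrank ℝ E) {θ : Π y : M, TangentSpace I y →ₗ[ℝ] ℝ}
    (hθ : ∀ i, MDiffAt (fun y => θ y (e i y)) x) :
    ∑ i, (mvfderiv I (fun y => θ y (extendVec I (onb I x i) y)) x (onb I x i)
        - θ x (leviCivita I (extendVec I (onb I x i)) x (onb I x i)))
      = ∑ j, (mvfderiv I (fun y => θ y (e j y)) x (e j x)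
        - θ x (leviCivita I (e j) x (e j x))) := by
  have h := sum_apply_apply_of_orthonormal (covDerivOneForm he ho hc hθ) (onb I x)
    ho.self_of_nhds hc
  rw [Finset.sum_congr rfl fun j _ => (covDerivOneForm_apply he ho hc hθ _ (he j)).symm, ← h]
  refine Finset.sum_congr rfl fun i _ => ?_
  have := covDerivOneForm_apply he ho hc hθ (onb I x i) (mdifferentiableAt_extendVec (onb I x i))
  rw [← this, extendVec_self]

theorem laplacian_eq_sum_frame (he : ∀ i, CMDiffAt ∞ (T% (e i)) x)
    (ho : ∀ᶠ y in 𝓝 x, Orthonormal ℝ (fun i => e i y))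
    (hc : Fintype.card ι = Module.finrank ℝ E) {u : M → ℝ} (hu : CMDiffAt ∞ u x) :
    laplacian I u x = ∑ j, (mvfderiv I (fun y => mvfderiv I u y (e j y)) x (e j x)
        - mvfderiv I u x (leviCivita I (e j) x (e j x))) :=
  divergence_eq_sum_frame (fun i => (he i).mdifferentiableAt (by simp)) ho hc
    (θ := fun y => (mvfderiv I u y).toLinearMap)
    fun i => (contMDiffAt_mvfderiv_apply hu (he i)).mdifferentiableAt (by simp)

omit [Fintype ι] in
theorem inner_leviCivita_frame (he : ∀ i, MDiffAt (T% (e i)) x)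
    (ho : ∀ᶠ y in 𝓝 x, Orthonormal ℝ (fun i => e i y)) (i j k : ι) :
    ⟪leviCivita I (e j) x (e i x), e k x⟫ = (1 / 2 : ℝ) *
      (⟪mlieBracket I (e i) (e j) x, e k x⟫ - ⟪mlieBracket I (e i) (e k) x, e j x⟫
        - ⟪mlieBracket I (e j) (e k) x, e i x⟫) := by
  classical
  have hconst : ∀ i j, mvfderiv I (fun y => ⟪e i y, e j y⟫) x = 0 := fun i j => by
    have : (fun y => ⟪e i y, e j y⟫) =ᶠ[𝓝 x] fun _ => if i = j then (1 : ℝ) else 0 := by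
      filter_upwards [ho] with y hy using orthonormal_iff_ite.1 hy i j
    rw [mvfderiv_congr this, mvfderiv_const]
  rw [inner_leviCivita (he i) (he j) (he k), koszul, hconst, hconst, hconst]
  simp

end Frames

section Pullback

variable {E : Type*} [NormedAddCommGroup E] [NormedSpace ℝ E] [FiniteDimensional ℝ E]
  {H : Type*} [TopologicalSpace H] {I : ModelWithCorners ℝ E H}
  {M : Type*} [TopologicalSpace M] [ChartedSpace H M]
  [IsManifold I ∞ M]

omit [FiniteDimensional ℝ E] in
theorem mdifferentiableAt_trivializationAt_snd {Y : Π x : M, TangentSpace I x} {x : M}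
    (hY : MDiffAt (T% Y) x) :
    MDiffAt (fun y => (trivializationAt E (fun y : M => TangentSpace I y) x
      (⟨y, Y y⟩ : TotalSpace E (fun y : M => TangentSpace I y))).2) x :=
  (mdifferentiableAt_totalSpace I (F := E) (E := fun y : M => TangentSpace I y) _).1 hY |>.2

variable [RiemannianBundle (fun x : M => TangentSpace I x)]
  [IsContMDiffRiemannianBundle I ∞ E (fun x : M => TangentSpace I x)]

/-- The Levi-Civita connection in the preferred trivialization: the derivative of the components
plus the derivative of the field with constant components. -/
theorem leviCivita_eq_symm_add {Y : Π x : M, TangentSpace I x} {x : M}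
    (hY : MDiffAt (T% Y) x) (v : TangentSpace I x) :
    leviCivita I Y x v = (trivializationAt E (fun y : M => TangentSpace I y) x).symm x
        (mvfderiv I (fun y => (trivializationAt E (fun y : M => TangentSpace I y) x
          (⟨y, Y y⟩ : TotalSpace E (fun y : M => TangentSpace I y))).2) x v)
      + leviCivita I (extendVec I (Y x)) x v := by
  set t := trivializationAt E (fun y : M => TangentSpace I y) x with ht
  set A : M → E := fun y => (t (⟨y, Y y⟩ : TotalSpace E (fun y : M => TangentSpace I y))).2 with hA
  have hAd : MDiffAt A x := mdifferentiableAt_trivializationAt_snd hY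
  have hx : x ∈ t.baseSet := FiberBundle.mem_baseSet_trivializationAt' x
  set b := Module.finBasis ℝ E
  set L : Fin (Module.finrank ℝ E) → E →L[ℝ] ℝ :=
    fun i => LinearMap.toContinuousLinearMap (b.coord i)
  have hL : ∀ w : E, w = ∑ i, L i w • b i := fun w => (b.sum_repr w).symm
  have hsum : ∀ y ∈ t.baseSet, ∀ w : E,
      t.symm y w = ∑ i, L i w • t.symm y (b i) := fun y hy w => by
    rw [← Bundle.Trivialization.coe_symmₗ (R := ℝ) t hy]
    conv_lhs => rw [hL w]
    simp
  set s : Fin (Module.finrank ℝ E) → Π y : M, TangentSpace I y := fun i y => t.symm y (b i)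
  have hs : ∀ i, MDiffAt (T% (s i)) x := fun i => by
    have h := mdifferentiableAt_extendVec (I := I) (t.symm x (b i))
    have h' : extendVec I (t.symm x (b i)) = s i := by
      funext y
      simp only [extendVec, FiberBundle.extend, ← ht, s]
      rw [t.apply_mk_symm hx]
    rwa [h'] at h
  have hc : ∀ i, MDiffAt (fun y => L i (A y)) x := fun i =>
    (L i).mdifferentiableAt.comp x hAd
  have hYs : ∀ᶠ y in 𝓝 x, Y y = ∑ i, L i (A y) • s i y := by
    filter_upwards [t.open_baseSet.mem_nhds hx] with y hy
    rw [← hsum y hy, hA, t.symm_apply_apply_mk hy]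
  have hE : ∀ᶠ y in 𝓝 x, extendVec I (Y x) y = ∑ i, L i (A x) • s i y :=
    mem_of_superset (t.open_baseSet.mem_nhds hx) fun y hy => hsum y hy (A x)
  rw [leviCivita_congr hYs, leviCivita_congr hE, leviCivita_sum_smul hc hs,
    leviCivita_sum_smul (fun _ => mdifferentiableAt_const) hs, hsum x hx, ← Finset.sum_add_distrib]
  refine Finset.sum_congr rfl fun i _ => ?_
  rw [mvfderiv_clm_comp (L i) hAd, mvfderiv_const]
  simp [s]

variable
  {E' : Type*} [NormedAddCommGroup E'] [NormedSpace ℝ E'] [FiniteDimensional ℝ E']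
  {H' : Type*} [TopologicalSpace H'] {J : ModelWithCorners ℝ E' H'}
  {N : Type*} [TopologicalSpace N] [ChartedSpace H' N] [IsManifold J ∞ N]
  [RiemannianBundle (fun q : N => TangentSpace J q)]
  [IsContMDiffRiemannianBundle J ∞ E' (fun q : N => TangentSpace J q)]
  {κ : Type*} [Fintype κ] {ε : κ → Π q : N, TangentSpace J q} {φ : M → N} {x : M}

omit [FiniteDimensional ℝ E] [IsManifold I ∞ M]
  [RiemannianBundle (fun x : M => TangentSpace I x)]
  [IsContMDiffRiemannianBundle I ∞ E (fun x : M => TangentSpace I x)] in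
theorem pullbackConnection_sum_smul {w : κ → M → ℝ} {W : Π y : M, TangentSpace J (φ y)}
    (hφ : MDiffAt φ x) (hε : ∀ a, MDiffAt (T% (ε a)) (φ x)) (hw : ∀ a, MDiffAt (w a) x)
    (hW : ∀ᶠ y in 𝓝 x, W y = ∑ a, w a y • ε a (φ y)) (v : TangentSpace I x) :
    pullbackConnection I J φ W x v
      = ∑ a, (mvfderiv I (w a) x v • ε a (φ x)
        + w a x • leviCivita J (ε a) (φ x) (mfderiv I J φ x v)) := by
  set t := trivializationAt E' (fun q : N => TangentSpace J q) (φ x) with ht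
  set A : κ → N → E' :=
    fun a q => (t (⟨q, ε a q⟩ : TotalSpace E' (fun q : N => TangentSpace J q))).2 with hA
  have hAd : ∀ a, MDiffAt (A a) (φ x) := fun a => mdifferentiableAt_trivializationAt_snd (hε a)
  have hx : φ x ∈ t.baseSet := FiberBundle.mem_baseSet_trivializationAt' (φ x)
  have hlin : ∀ q ∈ t.baseSet, ∀ c : κ → ℝ,
      (t (⟨q, ∑ a, c a • ε a q⟩ : TotalSpace E' (fun q : N => TangentSpace J q))).2
        = ∑ a, c a • A a q := fun q hq c => by
    have : ∀ u : TangentSpace J q,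
        (t (⟨q, u⟩ : TotalSpace E' (fun q : N => TangentSpace J q))).2
          = t.linearMapAt ℝ q u := fun u => by
      rw [Bundle.Trivialization.coe_linearMapAt_of_mem t hq]
    simp only [hA, this, map_sum, map_smul]
  have hWA : (fun y => (t (⟨φ y, W y⟩ : TotalSpace E' (fun q : N => TangentSpace J q))).2)
      =ᶠ[𝓝 x] fun y => ∑ a, w a y • A a (φ y) := by
    filter_upwards [hW, hφ.continuousAt.preimage_mem_nhds (t.open_baseSet.mem_nhds hx)]
      with y hy hyt
    rw [hy, hlin _ hyt]
  have hAφ : ∀ a, MDiffAt (fun y => A a (φ y)) x := fun a => (hAd a).comp x hφ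
  have hd : mvfderiv I (fun y => ∑ a, w a y • A a (φ y)) x v
      = ∑ a, (mvfderiv I (w a) x v • A a (φ x)
        + w a x • mvfderiv J (A a) (φ x) (mfderiv I J φ x v)) := by
    rw [mvfderiv_sum (u := fun a y => w a y • A a (φ y)) fun a => (hw a).smul (hAφ a)]
    simp only [sum_apply]
    refine Finset.sum_congr rfl fun a _ => ?_
    rw [← mvfderiv_comp_mfderiv_apply (hAd a) hφ, mvfderiv_fun_smul (hw a) (hAφ a)]
    simp [add_comm]
  have hlc : leviCivita J (extendVec J (W x)) (φ x) (mfderiv I J φ x v)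
      = ∑ a, w a x • leviCivita J (extendVec J (ε a (φ x))) (φ x) (mfderiv I J φ x v) := by
    have h : ∀ᶠ q in 𝓝 (φ x), extendVec J (W x) q
        = ∑ a, w a x • extendVec J (ε a (φ x)) q := by
      filter_upwards [t.open_baseSet.mem_nhds hx] with q hq
      simp only [extendVec, FiberBundle.extend, ← ht]
      rw [hW.self_of_nhds, hlin _ hx, ← Bundle.Trivialization.coe_symmₗ (R := ℝ) t hq]
      simp [hA]
    rw [leviCivita_congr h, leviCivita_sum_smul (fun _ => mdifferentiableAt_const)
      fun a => mdifferentiableAt_extendVec _]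
    simp [mvfderiv_const]
  rw [pullbackConnection, ← ht, mvfderiv_congr hWA, hd, hlc,
    ← Bundle.Trivialization.coe_symmₗ (R := ℝ) t hx,
    map_sum, ← Finset.sum_add_distrib]
  refine Finset.sum_congr rfl fun a _ => ?_
  rw [leviCivita_eq_symm_add (hε a), map_add, map_smul, map_smul, ← ht,
    Bundle.Trivialization.coe_symmₗ t hx, smul_add, add_assoc]
  congr 2
  exact t.symm_apply_apply_mk hx _

/-- The trace of the covariant derivative of a `φ⁻¹TN`-valued one-form `∑ Θᵃ ⊗ εₐ`, computed in a
local orthonormal frame. -/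
theorem sum_pullbackConnection_sub_eq {ι : Type*} [Fintype ι]
    {e : ι → Π x : M, TangentSpace I x}
    (he : ∀ i, MDiffAt (T% (e i)) x) (ho : ∀ᶠ y in 𝓝 x, Orthonormal ℝ (fun i => e i y))
    (hc : Fintype.card ι = Module.finrank ℝ E)
    (hφ : MDiffAt φ x) (hε : ∀ a, MDiffAt (T% (ε a)) (φ x))
    {Θ : κ → Π y : M, TangentSpace I y →ₗ[ℝ] ℝ}
    (hΘ : ∀ a i, MDiffAt (fun y => Θ a y (e i y)) x)
    {D : Π y : M, TangentSpace I y → TangentSpace J (φ y)}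
    (hD : ∀ᶠ y in 𝓝 x, ∀ v, D y v = ∑ a, Θ a y v • ε a (φ y)) :
    ∑ i, (pullbackConnection I J φ (fun y => D y (extendVec I (onb I x i) y)) x (onb I x i)
        - D x (leviCivita I (extendVec I (onb I x i)) x (onb I x i)))
      = ∑ a, ((∑ j, (mvfderiv I (fun y => Θ a y (e j y)) x (e j x)
            - Θ a x (leviCivita I (e j) x (e j x)))) • ε a (φ x)
          + ∑ j, Θ a x (e j x) • leviCivita J (ε a) (φ x) (mfderiv I J φ x (e j x))) := by
  have h1 : ∀ i, pullbackConnection I J φ (fun y => D y (extendVec I (onb I x i) y)) x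
        (onb I x i)
      = ∑ a, (mvfderiv I (fun y => Θ a y (extendVec I (onb I x i) y)) x (onb I x i) • ε a (φ x)
        + Θ a x (onb I x i) • leviCivita J (ε a) (φ x) (mfderiv I J φ x (onb I x i))) := fun i => by
    rw [pullbackConnection_sum_smul (w := fun a y => Θ a y (extendVec I (onb I x i) y)) hφ hε
      (fun a => mdifferentiableAt_oneForm_apply he ho hc (hΘ a) (mdifferentiableAt_extendVec _))
      (hD.mono fun y hy => hy _)]
    simp
  have h2 : ∀ a, ∑ i, Θ a x (onb I x i) •
        leviCivita J (ε a) (φ x) (mfderiv I J φ x (onb I x i))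
      = ∑ j, Θ a x (e j x) • leviCivita J (ε a) (φ x) (mfderiv I J φ x (e j x)) := fun a =>
    sum_apply_apply_of_orthonormal
      (LinearMap.mk₂ ℝ (fun v w => Θ a x v • leviCivitaHom (ε a) (φ x) (hε a)
          (mfderiv I J φ x w))
        (fun v v' w => by simp [add_smul]) (fun c v w => by simp [smul_smul])
        (fun v w w' => by rw [map_add, map_add, smul_add])
        (fun c v w => by rw [map_smul, map_smul, smul_comm]))
      (onb I x) ho.self_of_nhds hc
  simp only [h1, hD.self_of_nhds, ← Finset.sum_sub_distrib]
  rw [Finset.sum_comm]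
  refine Finset.sum_congr rfl fun a _ => ?_
  rw [← divergence_eq_sum_frame he ho hc (hΘ a), ← h2, Finset.sum_smul,
    ← Finset.sum_add_distrib]
  refine Finset.sum_congr rfl fun i _ => ?_
  rw [sub_smul]
  abel

end Pullback

section Surface

variable {E : Type*} [NormedAddCommGroup E] [NormedSpace ℝ E] [FiniteDimensional ℝ E]
  {H : Type*} [TopologicalSpace H] {I : ModelWithCorners ℝ E H}
  {M : Type*} [TopologicalSpace M] [ChartedSpace H M]

omit [FiniteDimensional ℝ E] in
theorem eventually_mdifferentiableAt_vectorField [IsManifold I ∞ M]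
    {Y : Π x : M, TangentSpace I x} {x : M}
    (hY : CMDiffAt ∞ (T% Y) x) : ∀ᶠ y in 𝓝 x, MDiffAt (T% Y) y := by
  have : IsManifold I 1 M := IsManifold.of_le (n := ∞) (by norm_num)
  filter_upwards [(contMDiffAt_iff_contMDiffAt_nhds (n := 1) (by simp)).1
    (hY.of_le (by norm_num))] with y hy using hy.mdifferentiableAt (by simp)

theorem contMDiffAt_mlieBracket [IsManifold I ∞ M] {x : M} {X Y : Π x : M, TangentSpace I x}
    (hX : CMDiffAt ∞ (T% X) x) (hY : CMDiffAt ∞ (T% Y) x) :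
    CMDiffAt ∞ (T% (mlieBracket I X Y)) x := by
  have : IsManifold I (((⊤ : ℕ∞) : WithTop ℕ∞) + 1) M := inferInstanceAs (IsManifold I ∞ M)
  have : IsManifold I (minSmoothness ℝ 2) M := by
    simpa using IsManifold.of_le (I := I) (M := M) (m := 2) (n := ∞) (by norm_cast)
  exact ContMDiffAt.mlieBracket_vectorField (m := ⊤) (n := ⊤) hX hY (by simp)

variable [RiemannianBundle (fun x : M => TangentSpace I x)]

/-- The coefficient of `ε a` in `[ε 0, ε 1]` for an orthonormal frame `ε`. -/
def frameCoeff (ε : Fin 2 → Π x : M, TangentSpace I x) (a : Fin 2) (x : M) : ℝ :=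
  ⟪mlieBracket I (ε 0) (ε 1) x, ε a x⟫

/-- The connection form `ω(v) = ⟨∇_v ε₁, ε₀⟩` of an orthonormal frame `ε` on a surface. -/
def connectionForm (ε : Fin 2 → Π x : M, TangentSpace I x) (x : M) :
    TangentSpace I x →ₗ[ℝ] ℝ where
  toFun v := frameCoeff ε 0 x * ⟪ε 0 x, v⟫ + frameCoeff ε 1 x * ⟪ε 1 x, v⟫
  map_add' v w := by rw [inner_add_right, inner_add_right]; ring
  map_smul' c v := by simp only [real_inner_smul_right, RingHom.id_apply, smul_eq_mul]; ring

omit [FiniteDimensional ℝ E] in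
theorem connectionForm_apply (ε : Fin 2 → Π x : M, TangentSpace I x) (x : M)
    (v : TangentSpace I x) : connectionForm ε x v
      = frameCoeff ε 0 x * ⟪ε 0 x, v⟫ + frameCoeff ε 1 x * ⟪ε 1 x, v⟫ := rfl

/-- The Gauss curvature in terms of the coefficients of `[ε 0, ε 1]`. -/
def frameCurvature (ε : Fin 2 → Π x : M, TangentSpace I x) (x : M) : ℝ :=
  mvfderiv I (frameCoeff ε 1) x (ε 0 x) - mvfderiv I (frameCoeff ε 0) x (ε 1 x)
    - frameCoeff ε 0 x ^ 2 - frameCoeff ε 1 x ^ 2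

variable [IsManifold I ∞ M] [IsContMDiffRiemannianBundle I ∞ E (fun x : M => TangentSpace I x)]
  {ε : Fin 2 → Π x : M, TangentSpace I x} {x : M}

theorem leviCivita_frame (hε : ∀ a, MDiffAt (T% (ε a)) x)
    (ho : ∀ᶠ y in 𝓝 x, Orthonormal ℝ (fun a => ε a y)) (hE : Module.finrank ℝ E = 2)
    (v : TangentSpace I x) :
    leviCivita I (ε 0) x v = -connectionForm ε x v • ε 1 x ∧
      leviCivita I (ε 1) x v = connectionForm ε x v • ε 0 x := by
  have hc : Fintype.card (Fin 2) = Module.finrank ℝ (TangentSpace I x) := by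
    rw [Fintype.card_fin]; exact hE.symm
  have hox := ho.self_of_nhds
  have hon := orthonormal_iff_ite.1 hox
  have hnorm : ∀ a, ‖ε a x‖ = 1 := hox.1
  have hv := sum_inner_smul_of_orthonormal hox hc v
  have hsw : mlieBracket I (ε 1) (ε 0) x = -mlieBracket I (ε 0) (ε 1) x :=
    mlieBracket_swap_apply
  have hself : ∀ a, mlieBracket I (ε a) (ε a) x = 0 := fun a => by simp
  constructor
  all_goals
    refine ext_inner_of_orthonormal hox hc fun k => ?_
    conv_lhs => rw [← hv, ← leviCivitaHom_apply (hε _)]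
    simp only [Fin.sum_univ_two, map_add, map_smul, leviCivitaHom_apply, inner_add_left,
      real_inner_smul_left, connectionForm_apply, frameCoeff,
      inner_leviCivita_frame hε ho, hsw, hself, inner_neg_left, inner_zero_left]
    fin_cases k <;> simp [hon, hnorm, hsw]
    all_goals ring

theorem leviCivita_frame_combination (hε : ∀ a, MDiffAt (T% (ε a)) x)
    (ho : ∀ᶠ y in 𝓝 x, Orthonormal ℝ (fun a => ε a y)) (hE : Module.finrank ℝ E = 2)
    {c₀ c₁ : M → ℝ} (h₀ : MDiffAt c₀ x) (h₁ : MDiffAt c₁ x) {Y : Π x : M, TangentSpace I x}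
    (hY : ∀ᶠ y in 𝓝 x, Y y = c₀ y • ε 0 y + c₁ y • ε 1 y) (v : TangentSpace I x) :
    leviCivita I Y x v
      = (mvfderiv I c₀ x v + c₁ x * connectionForm ε x v) • ε 0 x
        + (mvfderiv I c₁ x v - c₀ x * connectionForm ε x v) • ε 1 x := by
  obtain ⟨e0, e1⟩ := leviCivita_frame hε ho hE v
  have h := leviCivita_add (mdifferentiableAt_smul_vectorField h₀ (hε 0))
    (mdifferentiableAt_smul_vectorField h₁ (hε 1)) v
  have s0 := leviCivita_smul h₀ (hε 0) v
  have s1 := leviCivita_smul h₁ (hε 1) v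
  rw [leviCivita_congr hY]
  refine h.trans ((congrArg₂ (· + ·) s0 s1).trans ?_)
  rw [e0, e1]
  module

omit [IsManifold I ∞ M] [IsContMDiffRiemannianBundle I ∞ E (fun x : M => TangentSpace I x)] in
theorem eventually_eq_frame (ho : ∀ᶠ y in 𝓝 x, Orthonormal ℝ (fun a => ε a y))
    (hE : Module.finrank ℝ E = 2) (Y : Π x : M, TangentSpace I x) :
    ∀ᶠ y in 𝓝 x, Y y = ⟪ε 0 y, Y y⟫ • ε 0 y + ⟪ε 1 y, Y y⟫ • ε 1 y := by
  filter_upwards [eventually_eq_sum_inner_smul ho (by rw [Fintype.card_fin, hE]) Y] with y hy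
  rwa [Fin.sum_univ_two] at hy

theorem contMDiffAt_frameCoeff (hε : ∀ a, CMDiffAt ∞ (T% (ε a)) x) (a : Fin 2) :
    CMDiffAt ∞ (frameCoeff ε a) x :=
  contMDiffAt_inner (contMDiffAt_mlieBracket (hε 0) (hε 1)) (hε a)

theorem contMDiffAt_connectionForm (hε : ∀ a, CMDiffAt ∞ (T% (ε a)) x)
    {Y : Π x : M, TangentSpace I x} (hY : CMDiffAt ∞ (T% Y) x) :
    CMDiffAt ∞ (fun y => connectionForm ε y (Y y)) x :=
  ((contMDiffAt_frameCoeff hε 0).mul (contMDiffAt_inner (hε 0) hY)).add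
    ((contMDiffAt_frameCoeff hε 1).mul (contMDiffAt_inner (hε 1) hY))

/-- The structure equation `dω = K ε⁰ ∧ ε¹`. -/
theorem connectionForm_structure (hε : ∀ a, CMDiffAt ∞ (T% (ε a)) x)
    (ho : ∀ᶠ y in 𝓝 x, Orthonormal ℝ (fun a => ε a y)) (hE : Module.finrank ℝ E = 2)
    {X Y : Π x : M, TangentSpace I x} (hX : CMDiffAt ∞ (T% X) x) (hY : CMDiffAt ∞ (T% Y) x) :
    mvfderiv I (fun y => connectionForm ε y (Y y)) x (X x)
        - mvfderiv I (fun y => connectionForm ε y (X y)) x (Y x)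
        - connectionForm ε x (mlieBracket I X Y x)
      = frameCurvature ε x * (⟪ε 0 x, X x⟫ * ⟪ε 1 x, Y x⟫ - ⟪ε 1 x, X x⟫ * ⟪ε 0 x, Y x⟫) := by
  have hd : ∀ {u : M → ℝ}, CMDiffAt ∞ u x → MDiffAt u x :=
    fun h => h.mdifferentiableAt (by simp)
  have hε1 : ∀ a, MDiffAt (T% (ε a)) x := fun a => (hε a).mdifferentiableAt (by simp)
  have hF := fun a => hd (contMDiffAt_frameCoeff hε a)
  have hder : ∀ Z : Π x : M, TangentSpace I x, CMDiffAt ∞ (T% Z) x → ∀ v : TangentSpace I x,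
      mvfderiv I (fun y => connectionForm ε y (Z y)) x v
        = frameCoeff ε 0 x * mvfderiv I (fun y => ⟪ε 0 y, Z y⟫) x v
          + ⟪ε 0 x, Z x⟫ * mvfderiv I (frameCoeff ε 0) x v
          + (frameCoeff ε 1 x * mvfderiv I (fun y => ⟪ε 1 y, Z y⟫) x v
          + ⟪ε 1 x, Z x⟫ * mvfderiv I (frameCoeff ε 1) x v) := fun Z hZ v => by
    have i := fun a => hd (contMDiffAt_inner (hε a) hZ)
    have h : (fun y => connectionForm ε y (Z y))
        = frameCoeff ε 0 * (fun y => ⟪ε 0 y, Z y⟫)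
          + frameCoeff ε 1 * (fun y => ⟪ε 1 y, Z y⟫) := rfl
    rw [h, mvfderiv_add ((hF 0).mul (i 0)) ((hF 1).mul (i 1)), mvfderiv_mul (hF 0) (i 0),
      mvfderiv_mul (hF 1) (i 1)]
    simp
  have hcomb := fun (Z : Π x : M, TangentSpace I x) (hZ : CMDiffAt ∞ (T% Z) x) =>
    leviCivita_frame_combination hε1 ho hE (hd (contMDiffAt_inner (hε 0) hZ))
      (hd (contMDiffAt_inner (hε 1) hZ)) (eventually_eq_frame ho hE Z)
  have hFv : ∀ (a : Fin 2) (Z : Π x : M, TangentSpace I x),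
      mvfderiv I (frameCoeff ε a) x (Z x)
        = ⟪ε 0 x, Z x⟫ * mvfderiv I (frameCoeff ε a) x (ε 0 x)
          + ⟪ε 1 x, Z x⟫ * mvfderiv I (frameCoeff ε a) x (ε 1 x) := fun a Z => by
    conv_lhs => rw [(eventually_eq_frame ho hE Z).self_of_nhds]
    simp
  have hω : ∀ a b : ℝ, connectionForm ε x (a • ε 0 x + b • ε 1 x)
      = frameCoeff ε 0 x * a + frameCoeff ε 1 x * b := fun a b => by
    have hon := orthonormal_iff_ite.1 ho.self_of_nhds
    simp [connectionForm_apply, inner_add_right, real_inner_smul_right, hon, ho.self_of_nhds.1]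
  rw [← leviCivita_torsion (hX.mdifferentiableAt (by simp)) (hY.mdifferentiableAt (by simp)),
    map_sub, hcomb Y hY, hcomb X hX, hω, hω, hder Y hY, hder X hX, hFv 0 X, hFv 1 X, hFv 0 Y,
    hFv 1 Y, connectionForm_apply, connectionForm_apply, frameCurvature]
  ring

variable [I.Boundaryless]

/-- The curvature tensor of a surface. -/
theorem curvature_eq_frameCurvature_smul (hε : ∀ a, CMDiffAt ∞ (T% (ε a)) x)
    (ho : ∀ᶠ y in 𝓝 x, Orthonormal ℝ (fun a => ε a y)) (hE : Module.finrank ℝ E = 2)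
    (u v w : TangentSpace I x) :
    curvature I x u v w = frameCurvature ε x • (⟪v, w⟫ • u - ⟪u, w⟫ • v) := by
  have hd : ∀ {u : M → ℝ}, CMDiffAt ∞ u x → MDiffAt u x :=
    fun h => h.mdifferentiableAt (by simp)
  have hε1 : ∀ a, MDiffAt (T% (ε a)) x := fun a => (hε a).mdifferentiableAt (by simp)
  set Z := extendVec I w with hZdef
  have hZ : CMDiffAt ∞ (T% Z) x := contMDiffAt_extendVec w
  have hZx : Z x = w := extendVec_self w
  set z : Fin 2 → M → ℝ := fun a y => ⟪ε a y, Z y⟫ with hzdef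
  have hz : ∀ a, CMDiffAt ∞ (z a) x := fun a => contMDiffAt_inner (hε a) hZ
  have hin : ∀ Y : Π x : M, TangentSpace I x,
      ∀ᶠ y in 𝓝 x, leviCivita I Z y (Y y)
        = (mvfderiv I (z 0) y (Y y) + z 1 y * connectionForm ε y (Y y)) • ε 0 y
          + (mvfderiv I (z 1) y (Y y) - z 0 y * connectionForm ε y (Y y)) • ε 1 y := fun Y => by
    filter_upwards [eventually_all.2 fun a => eventually_mdifferentiableAt_vectorField (hε a),
      eventually_eventually_nhds.2 ho, eventually_mdifferentiableAt_vectorField hZ]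
      with y hy hoy hZy
    exact leviCivita_frame_combination hy hoy hE (mdifferentiableAt_inner (hy 0) hZy)
      (mdifferentiableAt_inner (hy 1) hZy) (eventually_eq_frame hoy hE Z) _
  have hout : ∀ Y : Π x : M, TangentSpace I x, CMDiffAt ∞ (T% Y) x → ∀ t : TangentSpace I x,
      leviCivita I (fun y => leviCivita I Z y (Y y)) x t
        = (mvfderiv I (fun y => mvfderiv I (z 0) y (Y y)) x t
            + (z 1 x * mvfderiv I (fun y => connectionForm ε y (Y y)) x t
              + connectionForm ε x (Y x) * mvfderiv I (z 1) x t)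
            + (mvfderiv I (z 1) x (Y x) - z 0 x * connectionForm ε x (Y x))
              * connectionForm ε x t) • ε 0 x
          + (mvfderiv I (fun y => mvfderiv I (z 1) y (Y y)) x t
            - (z 0 x * mvfderiv I (fun y => connectionForm ε y (Y y)) x t
              + connectionForm ε x (Y x) * mvfderiv I (z 0) x t)
            - (mvfderiv I (z 0) x (Y x) + z 1 x * connectionForm ε x (Y x))
              * connectionForm ε x t) • ε 1 x := fun Y hY t => by
    have k := hd (contMDiffAt_connectionForm hε hY)
    have d := fun a => hd (contMDiffAt_mvfderiv_apply (hz a) hY)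
    have m := fun a => (hd (hz a)).mul k
    rw [leviCivita_frame_combination hε1 ho hE
      (c₀ := (fun y => mvfderiv I (z 0) y (Y y)) + z 1 * fun y => connectionForm ε y (Y y))
      (c₁ := (fun y => mvfderiv I (z 1) y (Y y)) - z 0 * fun y => connectionForm ε y (Y y))
      ((d 0).add (m 1)) ((d 1).sub (m 0)) (hin Y), mvfderiv_add (d 0) (m 1),
      mvfderiv_sub (d 1) (m 0), mvfderiv_mul (hd (hz 1)) k, mvfderiv_mul (hd (hz 0)) k]
    simp
  have hu := contMDiffAt_extendVec u
  have hv := contMDiffAt_extendVec v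
  have hst := connectionForm_structure hε ho hE hu hv
  have hlast := (hin (mlieBracket I (extendVec I u) (extendVec I v))).self_of_nhds
  have hc := fun a => mvfderiv_mlieBracket_apply (hz a) hu hv
  have hon := orthonormal_iff_ite.1 ho.self_of_nhds
  have hnorm : ∀ a, ‖ε a x‖ = 1 := ho.self_of_nhds.1
  rw [curvature, ← hZdef, hout _ hv, hout _ hu, hlast, hc, hc]
  rw [extendVec_self, extendVec_self] at hst ⊢
  have hcard : Fintype.card (Fin 2) = Module.finrank ℝ (TangentSpace I x) := by
    rw [Fintype.card_fin]; exact hE.symm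
  have hvw := sum_inner_mul_inner_of_orthonormal ho.self_of_nhds hcard v w
  have huw := sum_inner_mul_inner_of_orthonormal ho.self_of_nhds hcard u w
  rw [Fin.sum_univ_two] at hvw huw
  have hz' : ∀ a, z a x = ⟪ε a x, w⟫ := fun a => by rw [hzdef, ← hZx]
  have huc : ∀ a, ⟪u, ε a x⟫ = ⟪ε a x, u⟫ := fun a => real_inner_comm _ _
  have hvc : ∀ a, ⟪v, ε a x⟫ = ⟪ε a x, v⟫ := fun a => real_inner_comm _ _
  refine ext_inner_of_orthonormal ho.self_of_nhds hcard fun k => ?_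
  rw [← hvw, ← huw]
  fin_cases k
  · simp [inner_add_left, inner_sub_left, real_inner_smul_left, hon, hnorm, hz', huc, hvc]
    linear_combination ⟪ε 1 x, w⟫ * hst
  · simp [inner_add_left, inner_sub_left, real_inner_smul_left, hon, hnorm, hz', huc, hvc]
    linear_combination -⟪ε 0 x, w⟫ * hst

end Surface

section Laplacian

variable {E : Type*} [NormedAddCommGroup E] [NormedSpace ℝ E] [FiniteDimensional ℝ E]
  {H : Type*} [TopologicalSpace H] {I : ModelWithCorners ℝ E H}
  {M : Type*} [TopologicalSpace M] [ChartedSpace H M] [IsManifold I ∞ M]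
  [RiemannianBundle (fun x : M => TangentSpace I x)]

theorem laplacian_neg (u : M → ℝ) (x : M) :
    laplacian I (fun y => -u y) x = -laplacian I u x := by
  simp only [laplacian, mvfderiv_fun_neg, neg_apply, ← Finset.sum_neg_distrib]
  exact Finset.sum_congr rfl fun i _ => by ring

end Laplacian

section ThreeToTwo

set_option linter.unusedSectionVars false

variable {M : Type*} [TopologicalSpace M] [ChartedSpace (EuclideanSpace ℝ (Fin 3)) M]
  [IsManifold (𝓡 3) ∞ M] [RiemannianBundle (fun x : M => TangentSpace (𝓡 3) x)]
  [IsContMDiffRiemannianBundle (𝓡 3) ∞ (EuclideanSpace ℝ (Fin 3))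
    (fun x : M => TangentSpace (𝓡 3) x)]
  {N : Type*} [TopologicalSpace N] [ChartedSpace (EuclideanSpace ℝ (Fin 2)) N]
  [IsManifold (𝓡 2) ∞ N] [RiemannianBundle (fun q : N => TangentSpace (𝓡 2) q)]
  [IsContMDiffRiemannianBundle (𝓡 2) ∞ (EuclideanSpace ℝ (Fin 2))
    (fun q : N => TangentSpace (𝓡 2) q)]

theorem gaussCurvature_eq_frameCurvature {ε : Fin 2 → Π q : N, TangentSpace (𝓡 2) q} {q : N}
    (hε : ∀ a, ContMDiffAt (𝓡 2) (𝓡 2).tangent ∞ (fun q => (⟨q, ε a q⟩ : TangentBundle (𝓡 2) N)) q)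
    (ho : ∀ᶠ r in 𝓝 q, Orthonormal ℝ (fun a => ε a r)) :
    gaussCurvature q = frameCurvature ε q := by
  have hon := (onb (𝓡 2) q).orthonormal
  have h01 : ⟪onb (𝓡 2) q (Fin.cast (finrank_tangentSpace_two q).symm 0),
      onb (𝓡 2) q (Fin.cast (finrank_tangentSpace_two q).symm 1)⟫ = (0 : ℝ) :=
    hon.2 (by simp)
  rw [gaussCurvature, sectionalCurvature,
    curvature_eq_frameCurvature_smul hε ho finrank_euclideanSpace_fin, h01, hon.1, hon.1]
  simp [real_inner_smul_left, hon.1]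

/-- The frame `e` near `x` is smooth, orthonormal and adapted to `p`, with `e 0`, `e 1` related to
the smooth orthonormal frame `ε` near `p x`. -/
structure IsAdaptedAt (p : M → N) (e : Fin 3 → Π x : M, TangentSpace (𝓡 3) x)
    (ε : Fin 2 → Π q : N, TangentSpace (𝓡 2) q) (x : M) : Prop where
  smooth_map : ContMDiffAt (𝓡 3) (𝓡 2) ∞ p x
  smooth_frame : ∀ i, ContMDiffAt (𝓡 3) (𝓡 3).tangent ∞ (fun y => (⟨y, e i y⟩ : TangentBundle (𝓡 3) M)) x
  smooth_base : ∀ a, ContMDiffAt (𝓡 2) (𝓡 2).tangent ∞ (fun q => (⟨q, ε a q⟩ : TangentBundle (𝓡 2) N)) (p x)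
  orthonormal_frame : ∀ᶠ y in 𝓝 x, Orthonormal ℝ (fun i => e i y)
  orthonormal_base : ∀ᶠ q in 𝓝 (p x), Orthonormal ℝ (fun a => ε a q)
  map_zero : ∀ᶠ y in 𝓝 x, mfderiv (𝓡 3) (𝓡 2) p y (e 0 y) = ε 0 (p y)
  map_one : ∀ᶠ y in 𝓝 x, mfderiv (𝓡 3) (𝓡 2) p y (e 1 y) = ε 1 (p y)
  map_two : ∀ᶠ y in 𝓝 x, mfderiv (𝓡 3) (𝓡 2) p y (e 2 y) = 0

namespace IsAdaptedAt

variable {p : M → N} {e : Fin 3 → Π x : M, TangentSpace (𝓡 3) x}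
  {ε : Fin 2 → Π q : N, TangentSpace (𝓡 2) q} {x : M}

theorem card_three (x : M) : Fintype.card (Fin 3) = Module.finrank ℝ (TangentSpace (𝓡 3) x) := by
  rw [Fintype.card_fin]
  exact (finrank_euclideanSpace_fin (𝕜 := ℝ) (n := 3)).symm

theorem mdiff_frame (h : IsAdaptedAt p e ε x) (i : Fin 3) : 
    MDifferentiableAt (𝓡 3) (𝓡 3).tangent (fun y => (⟨y, e i y⟩ : TangentBundle (𝓡 3) M)) x :=
  (h.smooth_frame i).mdifferentiableAt (by simp)

theorem mdiff_base (h : IsAdaptedAt p e ε x) (a : Fin 2) : 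
    MDifferentiableAt (𝓡 2) (𝓡 2).tangent (fun q => (⟨q, ε a q⟩ : TangentBundle (𝓡 2) N)) (p x) :=
  (h.smooth_base a).mdifferentiableAt (by simp)

theorem mdiff_map (h : IsAdaptedAt p e ε x) : MDifferentiableAt (𝓡 3) (𝓡 2) p x :=
  h.smooth_map.mdifferentiableAt (by simp)

theorem mfderiv_apply (h : IsAdaptedAt p e ε x) (v : TangentSpace (𝓡 3) x) :
    mfderiv (𝓡 3) (𝓡 2) p x v = ⟪e 0 x, v⟫ • ε 0 (p x) + ⟪e 1 x, v⟫ • ε 1 (p x) := by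
  conv_lhs => rw [← sum_inner_smul_of_orthonormal h.orthonormal_frame.self_of_nhds
    (card_three x) v]
  simp only [Fin.sum_univ_three, map_add, map_smul, h.map_zero.self_of_nhds,
    h.map_one.self_of_nhds, h.map_two.self_of_nhds, smul_zero, add_zero]

theorem inner_base (h : IsAdaptedAt p e ε x) (a b : Fin 2) :
    ⟪ε a (p x), ε b (p x)⟫ = if a = b then (1 : ℝ) else 0 :=
  orthonormal_iff_ite.1 h.orthonormal_base.self_of_nhds a b

theorem inner_frame (h : IsAdaptedAt p e ε x) (i j : Fin 3) :
    ⟪e i x, e j x⟫ = if i = j then (1 : ℝ) else 0 :=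
  orthonormal_iff_ite.1 h.orthonormal_frame.self_of_nhds i j

theorem inner_base_combination_zero (h : IsAdaptedAt p e ε x) (a b : ℝ) :
    ⟪ε 0 (p x), a • ε 0 (p x) + b • ε 1 (p x)⟫ = a := by
  rw [inner_add_right, real_inner_smul_right, real_inner_smul_right, h.inner_base, h.inner_base]
  simp

theorem inner_base_combination_one (h : IsAdaptedAt p e ε x) (a b : ℝ) :
    ⟪ε 1 (p x), a • ε 0 (p x) + b • ε 1 (p x)⟫ = b := by
  rw [inner_add_right, real_inner_smul_right, real_inner_smul_right, h.inner_base, h.inner_base]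
  simp

theorem connectionForm_mfderiv (h : IsAdaptedAt p e ε x) (v : TangentSpace (𝓡 3) x) :
    connectionForm ε (p x) (mfderiv (𝓡 3) (𝓡 2) p x v)
      = frameCoeff ε 0 (p x) * ⟪e 0 x, v⟫ + frameCoeff ε 1 (p x) * ⟪e 1 x, v⟫ := by
  rw [connectionForm_apply, h.mfderiv_apply, h.inner_base_combination_zero,
    h.inner_base_combination_one]

theorem frameCoeff_eq (h : IsAdaptedAt p e ε x) :
    frameCoeff ε 0 (p x) = bracketCoeff e 0 1 0 x ∧
      frameCoeff ε 1 (p x) = bracketCoeff e 0 1 1 x := by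
  have hb := mfderiv_mlieBracket_of_related h.smooth_map (h.smooth_frame 0) (h.smooth_frame 1)
    (h.smooth_base 0) (h.smooth_base 1) h.map_zero h.map_one
  rw [h.mfderiv_apply] at hb
  constructor
  · rw [frameCoeff, ← hb, real_inner_comm, h.inner_base_combination_zero, real_inner_comm]
    rfl
  · rw [frameCoeff, ← hb, real_inner_comm, h.inner_base_combination_one, real_inner_comm]
    rfl

theorem contMDiffAt_zero_vectorField (q : N) :
    ContMDiffAt (𝓡 2) (𝓡 2).tangent ∞ 
      (fun q => (⟨q, (0 : Π q : N, TangentSpace (𝓡 2) q) q⟩ : TangentBundle (𝓡 2) N)) q :=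
  contMDiff_zeroSection ℝ (fun q : N => TangentSpace (𝓡 2) q) |>.contMDiffAt

theorem bracketCoeff_vertical (h : IsAdaptedAt p e ε x) :
    (bracketCoeff e 0 2 0 x = 0 ∧ bracketCoeff e 0 2 1 x = 0) ∧
      bracketCoeff e 1 2 0 x = 0 ∧ bracketCoeff e 1 2 1 x = 0 := by
  have h0 := mfderiv_mlieBracket_of_related h.smooth_map (h.smooth_frame 0) (h.smooth_frame 2)
    (h.smooth_base 0) (contMDiffAt_zero_vectorField _) h.map_zero h.map_two
  have h1 := mfderiv_mlieBracket_of_related h.smooth_map (h.smooth_frame 1) (h.smooth_frame 2)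
    (h.smooth_base 1) (contMDiffAt_zero_vectorField _) h.map_one h.map_two
  rw [mlieBracket_zero_right, h.mfderiv_apply] at h0 h1
  refine ⟨⟨?_, ?_⟩, ?_, ?_⟩
  · have := h.inner_base_combination_zero ⟪e 0 x, mlieBracket (𝓡 3) (e 0) (e 2) x⟫
      ⟪e 1 x, mlieBracket (𝓡 3) (e 0) (e 2) x⟫
    rw [h0] at this
    rw [bracketCoeff, real_inner_comm, ← this]
    exact inner_zero_right _
  · have := h.inner_base_combination_one ⟪e 0 x, mlieBracket (𝓡 3) (e 0) (e 2) x⟫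
      ⟪e 1 x, mlieBracket (𝓡 3) (e 0) (e 2) x⟫
    rw [h0] at this
    rw [bracketCoeff, real_inner_comm, ← this]
    exact inner_zero_right _
  · have := h.inner_base_combination_zero ⟪e 0 x, mlieBracket (𝓡 3) (e 1) (e 2) x⟫
      ⟪e 1 x, mlieBracket (𝓡 3) (e 1) (e 2) x⟫
    rw [h1] at this
    rw [bracketCoeff, real_inner_comm, ← this]
    exact inner_zero_right _
  · have := h.inner_base_combination_one ⟪e 0 x, mlieBracket (𝓡 3) (e 1) (e 2) x⟫
      ⟪e 1 x, mlieBracket (𝓡 3) (e 1) (e 2) x⟫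
    rw [h1] at this
    rw [bracketCoeff, real_inner_comm, ← this]
    exact inner_zero_right _

theorem sum_leviCivita_frame (h : IsAdaptedAt p e ε x) :
    ∑ j, leviCivita (𝓡 3) (e j) x (e j x)
      = (frameCoeff ε 1 (p x) + bracketCoeff e 0 2 2 x) • e 0 x
        + (bracketCoeff e 1 2 2 x - frameCoeff ε 0 (p x)) • e 1 x := by
  obtain ⟨⟨b1, b2⟩, b3, b4⟩ := h.bracketCoeff_vertical
  obtain ⟨c1, c2⟩ := h.frameCoeff_eq
  rw [c1, c2]
  have hsw : ∀ i j, mlieBracket (𝓡 3) (e i) (e j) x = -mlieBracket (𝓡 3) (e j) (e i) x :=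
    fun i j => mlieBracket_swap_apply
  have key : ∀ j k, ⟪leviCivita (𝓡 3) (e j) x (e j x), e k x⟫ = -bracketCoeff e j k j x :=
    fun j k => by
      rw [inner_leviCivita_frame h.mdiff_frame h.orthonormal_frame, mlieBracket_self]
      simp only [Pi.zero_apply, inner_zero_left, bracketCoeff]
      ring
  have hself : ∀ i k, bracketCoeff e i i k x = 0 := fun i k => by simp [bracketCoeff]
  have hsw' : ∀ i j k, bracketCoeff e i j k x = -bracketCoeff e j i k x := fun i j k => by
    rw [bracketCoeff, hsw, inner_neg_left]; rfl
  refine ext_inner_of_orthonormal h.orthonormal_frame.self_of_nhds (card_three x) fun k => ?_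
  rw [Fin.sum_univ_three, inner_add_left, inner_add_left, key, key, key, inner_add_left,
    real_inner_smul_left, real_inner_smul_left, h.inner_frame, h.inner_frame]
  fin_cases k
  · simp [hself, hsw' 1 0, hsw' 2 0]
  · simp [hself, hsw' 2 1]
    ring
  · simp [hself, b1, b4]

/-- The divergence of a one-form in an adapted frame. -/
theorem sum_divergence (h : IsAdaptedAt p e ε x) (θ : Π y : M, TangentSpace (𝓡 3) y →ₗ[ℝ] ℝ) :
    ∑ j, (mvfderiv (𝓡 3) (fun y => θ y (e j y)) x (e j x)
        - θ x (leviCivita (𝓡 3) (e j) x (e j x)))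
      = mvfderiv (𝓡 3) (fun y => θ y (e 0 y)) x (e 0 x)
        + mvfderiv (𝓡 3) (fun y => θ y (e 1 y)) x (e 1 x)
        + mvfderiv (𝓡 3) (fun y => θ y (e 2 y)) x (e 2 x)
        - ((frameCoeff ε 1 (p x) + bracketCoeff e 0 2 2 x) * θ x (e 0 x)
        + (bracketCoeff e 1 2 2 x - frameCoeff ε 0 (p x)) * θ x (e 1 x)) := by
  have := congrArg (θ x) h.sum_leviCivita_frame
  simp only [map_add, map_smul, smul_eq_mul, map_sum] at this
  rw [← this, Finset.sum_sub_distrib, Fin.sum_univ_three]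

theorem finrank_three : Fintype.card (Fin 3) = Module.finrank ℝ (EuclideanSpace ℝ (Fin 3)) := by
  simp

/-- The trace of the covariant derivative of a one-form with values in the pullback bundle, in an
adapted frame. -/
theorem trace_covDeriv (h : IsAdaptedAt p e ε x)
    {Θ : Fin 2 → Π y : M, TangentSpace (𝓡 3) y →ₗ[ℝ] ℝ}
    (hΘ : ∀ a i, MDifferentiableAt (𝓡 3) 𝓘(ℝ, ℝ) (fun y => Θ a y (e i y)) x)
    {D : Π y : M, TangentSpace (𝓡 3) y → TangentSpace (𝓡 2) (p y)}
    (hD : ∀ᶠ y in 𝓝 x, ∀ v, D y v = Θ 0 y v • ε 0 (p y) + Θ 1 y v • ε 1 (p y)) :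
    ∑ i, (pullbackConnection (𝓡 3) (𝓡 2) p
          (fun y => D y (extendVec (𝓡 3) (onb (𝓡 3) x i) y)) x (onb (𝓡 3) x i)
        - D x (leviCivita (𝓡 3) (extendVec (𝓡 3) (onb (𝓡 3) x i)) x (onb (𝓡 3) x i)))
      = ((∑ j, (mvfderiv (𝓡 3) (fun y => Θ 0 y (e j y)) x (e j x)
            - Θ 0 x (leviCivita (𝓡 3) (e j) x (e j x))))
          + (Θ 1 x (e 0 x) * frameCoeff ε 0 (p x) + Θ 1 x (e 1 x) * frameCoeff ε 1 (p x)))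
            • ε 0 (p x)
        + ((∑ j, (mvfderiv (𝓡 3) (fun y => Θ 1 y (e j y)) x (e j x)
            - Θ 1 x (leviCivita (𝓡 3) (e j) x (e j x))))
          - (Θ 0 x (e 0 x) * frameCoeff ε 0 (p x) + Θ 0 x (e 1 x) * frameCoeff ε 1 (p x)))
            • ε 1 (p x) := by
  have hlc := fun v => leviCivita_frame h.mdiff_base h.orthonormal_base
    finrank_euclideanSpace_fin (mfderiv (𝓡 3) (𝓡 2) p x v)
  rw [sum_pullbackConnection_sub_eq h.mdiff_frame h.orthonormal_frame finrank_three h.mdiff_map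
    h.mdiff_base hΘ (by simpa only [Fin.sum_univ_two] using hD), Fin.sum_univ_two]
  simp only [(hlc _).1, (hlc _).2, h.connectionForm_mfderiv, h.inner_frame]
  simp only [Fin.sum_univ_three (fun j => Θ _ x (e j x) • _)]
  simp
  module

theorem tension_eq (h : IsAdaptedAt p e ε x) (hnear : ∀ᶠ y in 𝓝 x, IsAdaptedAt p e ε y) :
    tension (𝓡 3) (𝓡 2) p x
      = -bracketCoeff e 0 2 2 x • ε 0 (p x) + -bracketCoeff e 1 2 2 x • ε 1 (p x) := by
  let Θ : Fin 2 → Π y : M, TangentSpace (𝓡 3) y →ₗ[ℝ] ℝ :=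
    fun a y => (innerSL ℝ (e a.castSucc y)).toLinearMap
  have hconst : ∀ a i, (fun y => Θ a y (e i y)) =ᶠ[𝓝 x]
      fun _ => if a.castSucc = i then (1 : ℝ) else 0 := fun a i => by
    filter_upwards [hnear] with y hy using hy.inner_frame _ _
  have hΘ : ∀ a i, MDifferentiableAt (𝓡 3) 𝓘(ℝ, ℝ) (fun y => Θ a y (e i y)) x := fun a i =>
    MDifferentiableAt.congr_of_eventuallyEq mdifferentiableAt_const (hconst a i)
  have hval : ∀ a i, Θ a x (e i x) = if a.castSucc = i then (1 : ℝ) else 0 :=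
    fun a i => (hconst a i).self_of_nhds
  rw [tension, h.trace_covDeriv hΘ (D := fun y v => mfderiv (𝓡 3) (𝓡 2) p y v)
    (hnear.mono fun y hy v => hy.mfderiv_apply v), h.sum_divergence, h.sum_divergence]
  simp only [mvfderiv_congr (hconst _ _), mvfderiv_const, hval]
  simp

theorem pullbackConnection_eq (h : IsAdaptedAt p e ε x) {w : Fin 2 → M → ℝ}
    {W : Π y : M, TangentSpace (𝓡 2) (p y)}
    (hw : ∀ a, MDifferentiableAt (𝓡 3) 𝓘(ℝ, ℝ) (w a) x)
    (hW : ∀ᶠ y in 𝓝 x, W y = w 0 y • ε 0 (p y) + w 1 y • ε 1 (p y))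
    (v : TangentSpace (𝓡 3) x) :
    pullbackConnection (𝓡 3) (𝓡 2) p W x v
      = (mvfderiv (𝓡 3) (w 0) x v
          + w 1 x * connectionForm ε (p x) (mfderiv (𝓡 3) (𝓡 2) p x v)) • ε 0 (p x)
        + (mvfderiv (𝓡 3) (w 1) x v
          - w 0 x * connectionForm ε (p x) (mfderiv (𝓡 3) (𝓡 2) p x v)) • ε 1 (p x) := by
  obtain ⟨h0, h1⟩ := leviCivita_frame h.mdiff_base h.orthonormal_base
    finrank_euclideanSpace_fin (mfderiv (𝓡 3) (𝓡 2) p x v)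
  rw [pullbackConnection_sum_smul h.mdiff_map h.mdiff_base hw
    (by simpa only [Fin.sum_univ_two] using hW), Fin.sum_univ_two, h0, h1]
  module

/-- The trace of `R(dp, w) dp` for a Riemannian submersion onto a surface. -/
theorem sum_curvature (h : IsAdaptedAt p e ε x) (w : TangentSpace (𝓡 2) (p x)) :
    ∑ i, curvature (𝓡 2) (p x) (mfderiv (𝓡 3) (𝓡 2) p x (onb (𝓡 3) x i)) w
        (mfderiv (𝓡 3) (𝓡 2) p x (onb (𝓡 3) x i))
      = -frameCurvature ε (p x) • w := by
  let L : TangentSpace (𝓡 3) x →ₗ[ℝ] TangentSpace (𝓡 2) (p x) :=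
    (mfderiv (𝓡 3) (𝓡 2) p x).toLinearMap
  let S : TangentSpace (𝓡 3) x →ₗ[ℝ] TangentSpace (𝓡 3) x →ₗ[ℝ] TangentSpace (𝓡 2) (p x) :=
    LinearMap.mk₂ ℝ (fun u v => frameCurvature ε (p x) • (⟪w, L v⟫ • L u - ⟪L u, L v⟫ • w))
      (fun u u' v => by simp only [map_add, inner_add_left]; module)
      (fun c u v => by simp only [map_smul, real_inner_smul_left]; module)
      (fun u v v' => by simp only [map_add, inner_add_right]; module)
      (fun c u v => by simp only [map_smul, real_inner_smul_right]; module)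
  have hS : ∀ v, S v v = curvature (𝓡 2) (p x) (mfderiv (𝓡 3) (𝓡 2) p x v) w
      (mfderiv (𝓡 3) (𝓡 2) p x v) := fun v =>
    (curvature_eq_frameCurvature_smul h.smooth_base h.orthonormal_base
      finrank_euclideanSpace_fin _ _ _).symm
  have hw := sum_inner_smul_of_orthonormal h.orthonormal_base.self_of_nhds
    (by rw [Fintype.card_fin]; exact (finrank_tangentSpace_two (p x)).symm) w
  rw [Fin.sum_univ_two] at hw
  rw [← Finset.sum_congr rfl fun i _ => hS (onb (𝓡 3) x i),
    sum_apply_apply_of_orthonormal S _ h.orthonormal_frame.self_of_nhds (card_three x),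
    Fin.sum_univ_three, hS, hS, hS, h.map_zero.self_of_nhds, h.map_one.self_of_nhds,
    h.map_two.self_of_nhds]
  simp only [curvature_eq_frameCurvature_smul h.smooth_base h.orthonormal_base
      finrank_euclideanSpace_fin, h.inner_base, inner_zero_right]
  rw [real_inner_comm w, real_inner_comm w] at hw
  refine Eq.trans (b := frameCurvature ε (p x) • (⟪w, ε 0 (p x)⟫ • ε 0 (p x)
    + ⟪w, ε 1 (p x)⟫ • ε 1 (p x) - (2 : ℝ) • w)) ?_ (by rw [hw]; module)
  simp only [if_true]
  module

theorem laplacian_eq (h : IsAdaptedAt p e ε x) {u : M → ℝ}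
    (hu : ContMDiffAt (𝓡 3) 𝓘(ℝ, ℝ) ∞ u x) :
    laplacian (𝓡 3) u x
      = mvfderiv (𝓡 3) (fun y => mvfderiv (𝓡 3) u y (e 0 y)) x (e 0 x)
        + mvfderiv (𝓡 3) (fun y => mvfderiv (𝓡 3) u y (e 1 y)) x (e 1 x)
        + mvfderiv (𝓡 3) (fun y => mvfderiv (𝓡 3) u y (e 2 y)) x (e 2 x)
        - ((frameCoeff ε 1 (p x) + bracketCoeff e 0 2 2 x) * mvfderiv (𝓡 3) u x (e 0 x)
        + (bracketCoeff e 1 2 2 x - frameCoeff ε 0 (p x)) * mvfderiv (𝓡 3) u x (e 1 x)) := by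
  rw [laplacian_eq_sum_frame h.smooth_frame h.orthonormal_frame finrank_three hu]
  exact h.sum_divergence fun y => (mvfderiv (𝓡 3) u y).toLinearMap

theorem connectionForm_mfderiv_frame (h : IsAdaptedAt p e ε x) (j : Fin 3) :
    connectionForm ε (p x) (mfderiv (𝓡 3) (𝓡 2) p x (e j x))
      = ![frameCoeff ε 0 (p x), frameCoeff ε 1 (p x), 0] j := by
  rw [h.connectionForm_mfderiv, h.inner_frame, h.inner_frame]
  fin_cases j <;> simp

theorem contMDiffAt_frameCoeff_comp (h : IsAdaptedAt p e ε x) (a : Fin 2) :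
    ContMDiffAt (𝓡 3) 𝓘(ℝ, ℝ) ∞ (fun y => frameCoeff ε a (p y)) x :=
  (contMDiffAt_frameCoeff h.smooth_base a).comp x h.smooth_map

theorem mdifferentiableAt_connectionForm_frame (h : IsAdaptedAt p e ε x)
    (hnear : ∀ᶠ y in 𝓝 x, IsAdaptedAt p e ε y) (j : Fin 3) :
    MDifferentiableAt (𝓡 3) 𝓘(ℝ, ℝ)
      (fun y => connectionForm ε (p y) (mfderiv (𝓡 3) (𝓡 2) p y (e j y))) x := by
  have hF := fun a => (h.contMDiffAt_frameCoeff_comp a).mdifferentiableAt (by simp)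
  refine MDifferentiableAt.congr_of_eventuallyEq (f := fun y =>
    (![fun y => frameCoeff ε 0 (p y), fun y => frameCoeff ε 1 (p y), fun _ => 0] :
      Fin 3 → M → ℝ) j y) ?_ ?_
  · fin_cases j
    · exact hF 0
    · exact hF 1
    · exact mdifferentiableAt_const
  · filter_upwards [hnear] with y hy
    rw [hy.connectionForm_mfderiv_frame]
    fin_cases j <;> rfl

/-- The one-form `du + c ω(dp ·)`, for the connection form `ω` of `ε`. -/
def twistedForm (p : M → N) (ε : Fin 2 → Π q : N, TangentSpace (𝓡 2) q) (u c : M → ℝ) (y : M) :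
    TangentSpace (𝓡 3) y →ₗ[ℝ] ℝ :=
  (mvfderiv (𝓡 3) u y).toLinearMap
    + c y • (connectionForm ε (p y)).comp (mfderiv (𝓡 3) (𝓡 2) p y).toLinearMap

theorem twistedForm_apply (u c : M → ℝ) (y : M) (v : TangentSpace (𝓡 3) y) :
    twistedForm p ε u c y v = mvfderiv (𝓡 3) u y v
      + c y * connectionForm ε (p y) (mfderiv (𝓡 3) (𝓡 2) p y v) := rfl

theorem mdifferentiableAt_twistedForm (h : IsAdaptedAt p e ε x)
    (hnear : ∀ᶠ y in 𝓝 x, IsAdaptedAt p e ε y) {u c : M → ℝ}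
    (hu : ContMDiffAt (𝓡 3) 𝓘(ℝ, ℝ) ∞ u x) (hc : MDifferentiableAt (𝓡 3) 𝓘(ℝ, ℝ) c x)
    (j : Fin 3) :
    MDifferentiableAt (𝓡 3) 𝓘(ℝ, ℝ) (fun y => twistedForm p ε u c y (e j y)) x :=
  ((contMDiffAt_mvfderiv_apply hu (h.smooth_frame j)).mdifferentiableAt (by simp)).add
    (hc.mul (h.mdifferentiableAt_connectionForm_frame hnear j))

theorem mvfderiv_twistedForm (h : IsAdaptedAt p e ε x)
    (hnear : ∀ᶠ y in 𝓝 x, IsAdaptedAt p e ε y) {u c : M → ℝ}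
    (hu : ContMDiffAt (𝓡 3) 𝓘(ℝ, ℝ) ∞ u x) (hc : MDifferentiableAt (𝓡 3) 𝓘(ℝ, ℝ) c x)
    (j : Fin 3) {g : M → ℝ}
    (hg : ∀ᶠ y in 𝓝 x, connectionForm ε (p y) (mfderiv (𝓡 3) (𝓡 2) p y (e j y)) = g y)
    (v : TangentSpace (𝓡 3) x) :
    mvfderiv (𝓡 3) (fun y => twistedForm p ε u c y (e j y)) x v
      = mvfderiv (𝓡 3) (fun y => mvfderiv (𝓡 3) u y (e j y)) x v
        + (c x * mvfderiv (𝓡 3) g x v + g x * mvfderiv (𝓡 3) c x v) := by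
  have hω := h.mdifferentiableAt_connectionForm_frame hnear j
  have hm : MDifferentiableAt (𝓡 3) 𝓘(ℝ, ℝ)
      (fun y => c y * connectionForm ε (p y) (mfderiv (𝓡 3) (𝓡 2) p y (e j y))) x := hc.mul hω
  rw [← mvfderiv_congr hg, ← hg.self_of_nhds]
  simp only [twistedForm_apply]
  rw [mvfderiv_fun_add ((contMDiffAt_mvfderiv_apply hu (h.smooth_frame j)).mdifferentiableAt
    (by simp)) hm, mvfderiv_fun_mul hc hω]
  rfl

theorem sum_divergence_twistedForm (h : IsAdaptedAt p e ε x)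
    (hnear : ∀ᶠ y in 𝓝 x, IsAdaptedAt p e ε y) {u c : M → ℝ}
    (hu : ContMDiffAt (𝓡 3) 𝓘(ℝ, ℝ) ∞ u x) (hc : MDifferentiableAt (𝓡 3) 𝓘(ℝ, ℝ) c x) :
    ∑ j, (mvfderiv (𝓡 3) (fun y => twistedForm p ε u c y (e j y)) x (e j x)
        - twistedForm p ε u c x (leviCivita (𝓡 3) (e j) x (e j x)))
      = laplacian (𝓡 3) u x
        + (frameCoeff ε 0 (p x) * mvfderiv (𝓡 3) c x (e 0 x)
          + frameCoeff ε 1 (p x) * mvfderiv (𝓡 3) c x (e 1 x))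
        + c x * ((mvfderiv (𝓡 3) (fun y => frameCoeff ε 0 (p y)) x (e 0 x)
            - bracketCoeff e 0 2 2 x * frameCoeff ε 0 (p x))
          + (mvfderiv (𝓡 3) (fun y => frameCoeff ε 1 (p y)) x (e 1 x)
            - bracketCoeff e 1 2 2 x * frameCoeff ε 1 (p x))) := by
  have hω : ∀ j, ∀ᶠ y in 𝓝 x, connectionForm ε (p y) (mfderiv (𝓡 3) (𝓡 2) p y (e j y))
      = ![frameCoeff ε 0 (p y), frameCoeff ε 1 (p y), 0] j := fun j =>
    hnear.mono fun y hy => hy.connectionForm_mfderiv_frame j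
  rw [h.sum_divergence, h.laplacian_eq hu,
    h.mvfderiv_twistedForm hnear hu hc 0 (hω 0), h.mvfderiv_twistedForm hnear hu hc 1 (hω 1),
    h.mvfderiv_twistedForm hnear hu hc 2 (hω 2), twistedForm_apply, twistedForm_apply,
    h.connectionForm_mfderiv_frame, h.connectionForm_mfderiv_frame]
  have hz : mvfderiv (𝓡 3) (fun _ : M => (0 : ℝ)) x = 0 := mvfderiv_const _
  simp [hz]
  ring

/-- The Jacobi operator on a section `w 0 ε 0 + w 1 ε 1` of the pullback bundle. -/
theorem neg_jacobiOperator_eq (h : IsAdaptedAt p e ε x)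
    (hnear : ∀ᶠ y in 𝓝 x, IsAdaptedAt p e ε y) {w : Fin 2 → M → ℝ}
    {W : Π y : M, TangentSpace (𝓡 2) (p y)}
    (hw : ∀ a, ContMDiffAt (𝓡 3) 𝓘(ℝ, ℝ) ∞ (w a) x)
    (hW : ∀ᶠ y in 𝓝 x, W y = w 0 y • ε 0 (p y) + w 1 y • ε 1 (p y)) :
    -jacobiOperator (𝓡 3) (𝓡 2) p W x
      = (laplacian (𝓡 3) (w 0) x
          + 2 * (frameCoeff ε 0 (p x) * mvfderiv (𝓡 3) (w 1) x (e 0 x)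
            + frameCoeff ε 1 (p x) * mvfderiv (𝓡 3) (w 1) x (e 1 x))
          + w 1 x * ((mvfderiv (𝓡 3) (fun y => frameCoeff ε 0 (p y)) x (e 0 x)
              - bracketCoeff e 0 2 2 x * frameCoeff ε 0 (p x))
            + (mvfderiv (𝓡 3) (fun y => frameCoeff ε 1 (p y)) x (e 1 x)
              - bracketCoeff e 1 2 2 x * frameCoeff ε 1 (p x)))
          + w 0 x * (frameCurvature ε (p x)
            - (frameCoeff ε 0 (p x) ^ 2 + frameCoeff ε 1 (p x) ^ 2))) • ε 0 (p x)
        + (laplacian (𝓡 3) (w 1) x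
          - 2 * (frameCoeff ε 0 (p x) * mvfderiv (𝓡 3) (w 0) x (e 0 x)
            + frameCoeff ε 1 (p x) * mvfderiv (𝓡 3) (w 0) x (e 1 x))
          - w 0 x * ((mvfderiv (𝓡 3) (fun y => frameCoeff ε 0 (p y)) x (e 0 x)
              - bracketCoeff e 0 2 2 x * frameCoeff ε 0 (p x))
            + (mvfderiv (𝓡 3) (fun y => frameCoeff ε 1 (p y)) x (e 1 x)
              - bracketCoeff e 1 2 2 x * frameCoeff ε 1 (p x)))
          + w 1 x * (frameCurvature ε (p x)
            - (frameCoeff ε 0 (p x) ^ 2 + frameCoeff ε 1 (p x) ^ 2))) • ε 1 (p x) := by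
  have hwd : ∀ a, MDifferentiableAt (𝓡 3) 𝓘(ℝ, ℝ) (w a) x := fun a =>
    (hw a).mdifferentiableAt (by simp)
  have hwn : ∀ a, ∀ᶠ y in 𝓝 x, MDifferentiableAt (𝓡 3) 𝓘(ℝ, ℝ) (w a) y := fun a => by
    filter_upwards [(contMDiffAt_iff_contMDiffAt_nhds (n := 1) (by simp)).1
      ((hw a).of_le (by norm_num))] with y hy using hy.mdifferentiableAt (by simp)
  let c : Fin 2 → M → ℝ := ![w 1, fun y => -w 0 y]
  have hc : ∀ a, MDifferentiableAt (𝓡 3) 𝓘(ℝ, ℝ) (c a) x := by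
    intro a
    fin_cases a
    · exact hwd 1
    · exact (hwd 0).neg
  have hD : ∀ᶠ y in 𝓝 x, ∀ v, pullbackConnection (𝓡 3) (𝓡 2) p W y v
      = twistedForm p ε (w 0) (c 0) y v • ε 0 (p y)
        + twistedForm p ε (w 1) (c 1) y v • ε 1 (p y) := by
    filter_upwards [hnear, eventually_all.2 hwn, eventually_eventually_nhds.2 hW]
      with y hy hwy hWy v
    rw [hy.pullbackConnection_eq hwy hWy, twistedForm_apply, twistedForm_apply]
    simp only [c, Matrix.cons_val_zero, Matrix.cons_val_one]
    module
  have hc1 : mvfderiv (𝓡 3) (c 1) x = -mvfderiv (𝓡 3) (w 0) x := mvfderiv_fun_neg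
  have hc0 : c 0 = w 1 := rfl
  have hc1' : c 1 x = -w 0 x := rfl
  rw [jacobiOperator, neg_neg, h.sum_curvature, hW.self_of_nhds,
    h.trace_covDeriv (Θ := fun a => twistedForm p ε (w a) (c a))
      (fun a j => h.mdifferentiableAt_twistedForm hnear (hw a) (hc a) j) hD,
    h.sum_divergence_twistedForm hnear (hw 0) (hc 0),
    h.sum_divergence_twistedForm hnear (hw 1) (hc 1), hc1, hc1', hc0]
  simp only [twistedForm_apply, h.connectionForm_mfderiv_frame, hc1',
    Matrix.cons_val_zero, Matrix.cons_val_one, neg_apply]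
  module

end IsAdaptedAt

variable {p : M → N} {e : Fin 3 → Π x : M, TangentSpace (𝓡 3) x}
  {ε : Fin 2 → Π q : N, TangentSpace (𝓡 2) q} {x : M}

theorem IsAdaptedFrame.exists_isAdaptedAt {U : Set M} (he : IsAdaptedFrame p U e)
    (hp : ContMDiff (𝓡 3) (𝓡 2) ∞ p) (hU : IsOpen U) :
    ∃ ε : Fin 2 → Π q : N, TangentSpace (𝓡 2) q, ∀ x ∈ U, IsAdaptedAt p e ε x := by
  obtain ⟨V, ε, hV, hUV, hε, ho, hb⟩ := he.basic
  refine ⟨ε, fun x hx => ?_⟩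
  have hx' : ∀ᶠ y in 𝓝 x, y ∈ U := hU.mem_nhds hx
  have hp' : ∀ᶠ q in 𝓝 (p x), q ∈ V := hV.mem_nhds (hUV hx)
  exact
    { smooth_map := hp.contMDiffAt
      smooth_frame := fun i => (he.smooth i).contMDiffAt hx'
      smooth_base := fun a => (hε a).contMDiffAt hp'
      orthonormal_frame := hx'.mono he.orthonormal
      orthonormal_base := hp'.mono ho
      map_zero := hx'.mono fun y hy => hb y hy 0
      map_one := hx'.mono fun y hy => hb y hy 1
      map_two := hx'.mono he.vertical }

theorem contMDiffAt_bracketCoeff (he : ∀ i, ContMDiffAt (𝓡 3) (𝓡 3).tangent ∞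
    (fun y => (⟨y, e i y⟩ : TangentBundle (𝓡 3) M)) x) (i j k : Fin 3) :
    ContMDiffAt (𝓡 3) 𝓘(ℝ, ℝ) ∞ (bracketCoeff e i j k) x :=
  contMDiffAt_inner (contMDiffAt_mlieBracket (he i) (he j)) (he k)

namespace IsAdaptedAt

theorem combination_eq_zero_iff (h : IsAdaptedAt p e ε x) {a b : ℝ} :
    a • ε 0 (p x) + b • ε 1 (p x) = 0 ↔ a = 0 ∧ b = 0 := by
  refine ⟨fun hab => ⟨?_, ?_⟩, fun ⟨ha, hb⟩ => by rw [ha, hb, zero_smul, zero_smul, add_zero]⟩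
  · rw [← h.inner_base_combination_zero a b, hab]
    exact inner_zero_right _
  · rw [← h.inner_base_combination_one a b, hab]
    exact inner_zero_right _

theorem gaussCurvature_eq (h : IsAdaptedAt p e ε x) :
    gaussCurvature (p x) = mvfderiv (𝓡 3) (fun y => frameCoeff ε 1 (p y)) x (e 0 x)
      - mvfderiv (𝓡 3) (fun y => frameCoeff ε 0 (p y)) x (e 1 x)
      - frameCoeff ε 0 (p x) ^ 2 - frameCoeff ε 1 (p x) ^ 2 := by
  have hF := fun a => (contMDiffAt_frameCoeff h.smooth_base a).mdifferentiableAt (by simp)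
  rw [gaussCurvature_eq_frameCurvature h.smooth_base h.orthonormal_base,
    mvfderiv_comp_mfderiv_apply (hF 0) h.mdiff_map, mvfderiv_comp_mfderiv_apply (hF 1) h.mdiff_map,
    h.map_zero.self_of_nhds, h.map_one.self_of_nhds]
  rfl

theorem fBitension_eq_zero_iff (h : IsAdaptedAt p e ε x)
    (hnear : ∀ᶠ y in 𝓝 x, IsAdaptedAt p e ε y) {f f₁ f₂ κ₁ κ₂ : M → ℝ}
    (hf : ContMDiffAt (𝓡 3) 𝓘(ℝ, ℝ) ∞ f x)
    (hf₁ : ∀ᶠ y in 𝓝 x, f₁ y = frameCoeff ε 0 (p y))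
    (hf₂ : ∀ᶠ y in 𝓝 x, f₂ y = frameCoeff ε 1 (p y))
    (hκ₁ : ∀ᶠ y in 𝓝 x, κ₁ y = bracketCoeff e 0 2 2 y)
    (hκ₂ : ∀ᶠ y in 𝓝 x, κ₂ y = bracketCoeff e 1 2 2 y) :
    fBitension (𝓡 3) (𝓡 2) f p x = 0 ↔
      (-laplacian (𝓡 3) (fun y => f y * κ₁ y) x
          - 2 * (f₁ x * lieDeriv (e 0) (fun y => f y * κ₂ y) x
            + f₂ x * lieDeriv (e 1) (fun y => f y * κ₂ y) x)
          - f x * κ₂ x * ((lieDeriv (e 0) f₁ x - κ₁ x * f₁ x)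
            + (lieDeriv (e 1) f₂ x - κ₂ x * f₂ x))
          + f x * κ₁ x * (-gaussCurvature (p x) + (f₁ x ^ 2 + f₂ x ^ 2)) = 0) ∧
        (-laplacian (𝓡 3) (fun y => f y * κ₂ y) x
          + 2 * (f₁ x * lieDeriv (e 0) (fun y => f y * κ₁ y) x
            + f₂ x * lieDeriv (e 1) (fun y => f y * κ₁ y) x)
          + f x * κ₁ x * ((lieDeriv (e 0) f₁ x - κ₁ x * f₁ x)
            + (lieDeriv (e 1) f₂ x - κ₂ x * f₂ x))
          + f x * κ₂ x * (-gaussCurvature (p x) + (f₁ x ^ 2 + f₂ x ^ 2)) = 0) := by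
  have hs : ∀ {κ : M → ℝ} {i j k : Fin 3}, (∀ᶠ y in 𝓝 x, κ y = bracketCoeff e i j k y) →
      ContMDiffAt (𝓡 3) 𝓘(ℝ, ℝ) ∞ (fun y => -(f y * κ y)) x := fun hκ =>
    (hf.mul ((contMDiffAt_bracketCoeff h.smooth_frame _ _ _).congr_of_eventuallyEq hκ)).neg
  let w : Fin 2 → M → ℝ := ![fun y => -(f y * κ₁ y), fun y => -(f y * κ₂ y)]
  have hw : ∀ a, ContMDiffAt (𝓡 3) 𝓘(ℝ, ℝ) ∞ (w a) x := by
    intro a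
    fin_cases a
    · exact hs hκ₁
    · exact hs hκ₂
  have hW : ∀ᶠ y in 𝓝 x, f y • tension (𝓡 3) (𝓡 2) p y
      = w 0 y • ε 0 (p y) + w 1 y • ε 1 (p y) := by
    filter_upwards [hnear, eventually_eventually_nhds.2 hnear, hκ₁, hκ₂] with y hy hy' h₁ h₂
    rw [hy.tension_eq hy', ← h₁, ← h₂]
    simp only [w, Matrix.cons_val_zero, Matrix.cons_val_one]
    module
  have hw0 : w 0 = fun y => -(f y * κ₁ y) := rfl
  have hw1 : w 1 = fun y => -(f y * κ₂ y) := rfl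
  rw [fBitension, h.neg_jacobiOperator_eq hnear hw hW, h.combination_eq_zero_iff,
    ← gaussCurvature_eq_frameCurvature h.smooth_base h.orthonormal_base, hw0, hw1,
    laplacian_neg, laplacian_neg, ← mvfderiv_congr hf₁, ← mvfderiv_congr hf₂,
    ← hf₁.self_of_nhds, ← hf₂.self_of_nhds, ← hκ₁.self_of_nhds, ← hκ₂.self_of_nhds,
    mvfderiv_fun_neg, mvfderiv_fun_neg]
  simp only [lieDeriv, neg_apply]
  refine and_congr (Eq.congr ?_ rfl) (Eq.congr ?_ rfl) <;> ring

end IsAdaptedAt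

end ThreeToTwo

end FBiharmonic

end

theorem mainTheorem7
    {M : Type*} [TopologicalSpace M] [T2Space M] [ChartedSpace (EuclideanSpace ℝ (Fin 3)) M]
    [IsManifold (𝓡 3) ∞ M] [RiemannianBundle (fun x : M => TangentSpace (𝓡 3) x)]
    [IsContMDiffRiemannianBundle (𝓡 3) ∞ (EuclideanSpace ℝ (Fin 3))
      (fun x : M => TangentSpace (𝓡 3) x)]
    {N : Type*} [TopologicalSpace N] [T2Space N] [ChartedSpace (EuclideanSpace ℝ (Fin 2)) N]
    [IsManifold (𝓡 2) ∞ N] [RiemannianBundle (fun q : N => TangentSpace (𝓡 2) q)]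
    [IsContMDiffRiemannianBundle (𝓡 2) ∞ (EuclideanSpace ℝ (Fin 2))
      (fun q : N => TangentSpace (𝓡 2) q)]
    (p : M → N) (hp : FBiharmonic.IsRiemannianSubmersion (𝓡 3) (𝓡 2) p)
    (f : M → ℝ) (hf : ContMDiff (𝓡 3) 𝓘(ℝ, ℝ) ∞ f) (hf_pos : ∀ x, 0 < f x)
    (U : Set M) (hU : IsOpen U)
    (e : Fin 3 → Π x : M, TangentSpace (𝓡 3) x) (he : FBiharmonic.IsAdaptedFrame p U e)
    (f₁ f₂ κ₁ κ₂ σ : M → ℝ) (hdata : FBiharmonic.IsIntegrabilityData U e f₁ f₂ κ₁ κ₂ σ) :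
    (∀ x ∈ U, FBiharmonic.gaussCurvature (p x)
        = FBiharmonic.lieDeriv (e 0) f₂ x - FBiharmonic.lieDeriv (e 1) f₁ x
          - f₁ x ^ 2 - f₂ x ^ 2) ∧
    (FBiharmonic.IsFBiharmonicOn (𝓡 3) (𝓡 2) f p U ↔
      ∀ x ∈ U,
        (-FBiharmonic.laplacian (𝓡 3) (fun y => f y * κ₁ y) x
          - 2 * (f₁ x * FBiharmonic.lieDeriv (e 0) (fun y => f y * κ₂ y) x
            + f₂ x * FBiharmonic.lieDeriv (e 1) (fun y => f y * κ₂ y) x)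
          - f x * κ₂ x * ((FBiharmonic.lieDeriv (e 0) f₁ x - κ₁ x * f₁ x)
            + (FBiharmonic.lieDeriv (e 1) f₂ x - κ₂ x * f₂ x))
          + f x * κ₁ x * (-FBiharmonic.gaussCurvature (p x) + (f₁ x ^ 2 + f₂ x ^ 2)) = 0) ∧
        (-FBiharmonic.laplacian (𝓡 3) (fun y => f y * κ₂ y) x
          + 2 * (f₁ x * FBiharmonic.lieDeriv (e 0) (fun y => f y * κ₁ y) x
            + f₂ x * FBiharmonic.lieDeriv (e 1) (fun y => f y * κ₁ y) x)
          + f x * κ₁ x * ((FBiharmonic.lieDeriv (e 0) f₁ x - κ₁ x * f₁ x)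
            + (FBiharmonic.lieDeriv (e 1) f₂ x - κ₂ x * f₂ x))
          + f x * κ₂ x * (-FBiharmonic.gaussCurvature (p x) + (f₁ x ^ 2 + f₂ x ^ 2)) = 0)) := by
  obtain ⟨ε, hε⟩ := he.exists_isAdaptedAt hp.smooth hU
  have hnear : ∀ x ∈ U, ∀ᶠ y in nhds x, y ∈ U := fun x hx => hU.mem_nhds hx
  have h₁ : ∀ y ∈ U, f₁ y = FBiharmonic.frameCoeff ε 0 (p y) := fun y hy =>
    (hdata.f₁_eq y hy).symm.trans (hε y hy).frameCoeff_eq.1.symm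
  have h₂ : ∀ y ∈ U, f₂ y = FBiharmonic.frameCoeff ε 1 (p y) := fun y hy =>
    (hdata.f₂_eq y hy).symm.trans (hε y hy).frameCoeff_eq.2.symm
  refine ⟨fun x hx => ?_, forall₂_congr fun x hx => ?_⟩
  · rw [(hε x hx).gaussCurvature_eq, FBiharmonic.lieDeriv, FBiharmonic.lieDeriv,
      FBiharmonic.mvfderiv_congr ((hnear x hx).mono h₁),
      FBiharmonic.mvfderiv_congr ((hnear x hx).mono h₂), h₁ x hx, h₂ x hx]
  · exact (hε x hx).fBitension_eq_zero_iff ((hnear x hx).mono hε) hf.contMDiffAt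
      ((hnear x hx).mono h₁) ((hnear x hx).mono h₂)
      ((hnear x hx).mono fun y hy => (hdata.κ₁_eq y hy).symm)
      ((hnear x hx).mono fun y hy => (hdata.κ₂_eq y hy).symm)
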